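/- Let $\mathcal A=(Q,\Sigma,\delta,q_I,F)$ be a nondeterministic Büchi automaton ($Q$, $\Sigma$ finite, $\delta\subseteq Q\times\Sigma\times Q$), and let $\mathcal B=(Q,\Sigma,\delta,q_I',F)$ differ from $\mathcal A$ only in its initial state. For $w\in\Sigma^*$ write $q\xrightarrow{w}q'$ if there is a $w$-path from $q$ to $q'$, and $q\overset{w}{\Rightarrow}q'$ if there is one that visits $F$ at a position other than its first. Let $f_w:Q^2\to\{0,1,2\}$ be $f_w(q,q')=0$ if $q\overset{w}{\Rightarrow}q'$, $1$ if there is no $w$-path from $q$ to $q'$, and $2$ otherwise. Put $w\sim w'$ iff $f_w=f_{w'}$; this is a congruence, $[w]$ denotes the class of $w$, and $\Sigma^*/{\sim}$ is the transition monoid. Whether $q\xrightarrow{w}q'$, respectively $q\overset{w}{\Rightarrow}q'$, depends only on $[w]$. The continuous quotient game is played by Refuter, with a pebble initially on $q_0=q_I$, and Prover, with a pebble initially on $q_0'=q_I'$, with an abstract buffer initially $\beta=[\epsilon]$. In round $i\ge 1$, Refuter chooses classes $[w_1],[w_2]$ and a state $q_i$ with $q_{i-1}\xrightarrow{w_1}q_i\overset{w_2}{\Rightarrow}q_i$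 and $[w_2w_2]=[w_2]$; then Prover chooses $q_i'$ with $q_{i-1}'\xrightarrow{\beta w_1w_2}q_i'\overset{w_2}{\Rightarrow}q_i'$, and $\beta$ becomes $[w_2]$. Prover wins a play if Refuter gets stuck or the play is infinite; otherwise Refuter wins. The arena consists of the configurations $(q,q',\beta)$ (Refuter to move) and $(q,q',\beta,[w_1],[w_2])$ (Prover to move), with $q,q'\in Q$ and $\beta,[w_1],[w_2]\in\Sigma^*/{\sim}$. Then: 1. Whether Prover has a winning strategy for the continuous quotient game is decidable in EXPTIME: the set of bit strings encoding those $(\mathcal A,q_I')$ for which Prover has a winning strategy is decided by a Turing machine in time $2^{p(n)}$ in the input length $n$, for some polynomial $p$. (The encoding lists $|Q|$, $|\Sigma|$ and the initial states in unary, the characteristic vector of $F$ and the table of $\delta$.) 2. The arena is finite, and there is an absolute constant $C$ such that its number of configurations is at most $2^{C\,|Q|^2\log|Q|}$ whenever $|Q|\ge 2$. 3. The transition monoid is computable in exponential time: some Turing machine, given the encoding of $(\mathcal A,q_I')$, of length $n$, outputs in time $2^{p(n)}$, for some polynomial $p$, a list without repetitions of the functions $f_w$ of all elements of $\Sigma^*/{\sim}$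 together with the multiplication table of the monoid. 4. The game is a reachability game from Refuter's point of view: Refuter wins a play if and only if it reaches a configuration in which Prover is to move and stuck. -/

import Mathlib

namespace BuchiQuotient

universe u v

/-! ### Büchi automata, paths and the transition monoid -/

/-- A nondeterministic Büchi automaton with state set `Q` and alphabet `S`. -/
structure NBA (Q : Type u) (S : Type v) where
  /-- the transition relation -/
  δ : Set (Q × S × Q)
  /-- the initial state -/
  start : Q
  /-- the accepting states -/
  F : Set Q

namespace NBA

variable {Q : Type u} {S : Type v}

/-- `A.Reach q w q'`: there is a `w`-path from `q` to `q'`. -/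
def Reach (A : NBA Q S) : Q → List S → Q → Prop
  | q, [], q' => q = q'
  | q, a :: w, q' => ∃ r, (q, a, r) ∈ A.δ ∧ A.Reach r w q'

/-- `A.AccReach q w q'`: there is a `w`-path from `q` to `q'` that visits an accepting state
at some position other than its first one (so there is none for the empty word). -/
def AccReach (A : NBA Q S) : Q → List S → Q → Prop
  | _, [], _ => False
  | q, a :: w, q' => ∃ r, (q, a, r) ∈ A.δ ∧ ((r ∈ A.F ∧ A.Reach r w q') ∨ A.AccReach r w q')

theorem AccReach.reach {A : NBA Q S} {w : List S} {q q' : Q} (h : A.AccReach q w q') :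
    A.Reach q w q' := by
  induction w generalizing q with
  | nil => exact h.elim
  | cons a w ih =>
    obtain ⟨r, hr, h | h⟩ := h
    · exact ⟨r, hr, h.2⟩
    · exact ⟨r, hr, ih h⟩

theorem reach_append (A : NBA Q S) (u w : List S) (q q' : Q) :
    A.Reach q (u ++ w) q' ↔ ∃ r, A.Reach q u r ∧ A.Reach r w q' := by
  induction u generalizing q with
  | nil => simp [Reach]
  | cons a u ih =>
    simp only [List.cons_append, Reach, ih]
    grind

theorem accReach_append (A : NBA Q S) (u w : List S) (q q' : Q) :
    A.AccReach q (u ++ w) q' ↔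
      ∃ r, (A.AccReach q u r ∧ A.Reach r w q') ∨ (A.Reach q u r ∧ A.AccReach r w q') := by
  induction u generalizing q with
  | nil => simp [Reach, AccReach]
  | cons a u ih =>
    simp only [List.cons_append, Reach, AccReach, ih, reach_append]
    grind

open scoped Classical in
/-- The function `f_w : Q² → {0, 1, 2}`. -/
noncomputable def profile (A : NBA Q S) (w : List S) (q q' : Q) : Fin 3 :=
  if A.AccReach q w q' then 0 else if ¬ A.Reach q w q' then 1 else 2

theorem profile_eq_zero_iff (A : NBA Q S) (w : List S) (q q' : Q) :
    A.profile w q q' = 0 ↔ A.AccReach q w q' := by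
  unfold profile; split_ifs <;> simp_all

theorem profile_eq_one_iff (A : NBA Q S) (w : List S) (q q' : Q) :
    A.profile w q q' = 1 ↔ ¬ A.Reach q w q' := by
  unfold profile
  split_ifs with h1 h2
  · simp [h1.reach]
  · simpa using h2
  · simpa using h2

theorem profile_eq_iff (A : NBA Q S) (u w : List S) :
    A.profile u = A.profile w ↔ ∀ q q',
      (A.Reach q u q' ↔ A.Reach q w q') ∧ (A.AccReach q u q' ↔ A.AccReach q w q') := by
  constructor
  · intro h q q'
    have e := congrFun (congrFun h q) q'
    have h0 := A.profile_eq_zero_iff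
    have h1 := A.profile_eq_one_iff
    refine ⟨not_iff_not.1 ?_, ?_⟩
    · rw [← h1, ← h1, e]
    · rw [← h0, ← h0, e]
  · intro h
    funext q q'
    obtain ⟨h1, h2⟩ := h q q'
    unfold profile
    split_ifs <;> simp_all

/-- The congruence `∼` on finite words: `w ∼ w'` iff `f_w = f_w'`. -/
def wordCon (A : NBA Q S) : Con (FreeMonoid S) where
  r w w' := A.profile w.toList = A.profile w'.toList
  iseqv := ⟨fun _ => rfl, fun h => h.symm, fun h h' => h.trans h'⟩
  mul' := by
    intro w x y z h h'
    rw [profile_eq_iff] at h h' ⊢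
    intro q q'
    simp only [FreeMonoid.toList_mul, reach_append, accReach_append, h, h', and_self]

/-- The transition monoid `Σ*/∼`, with the multiplication induced by concatenation. -/
abbrev TransMonoid (A : NBA Q S) : Type v := A.wordCon.Quotient

/-- The class `[w]`. -/
def cls (A : NBA Q S) (w : List S) : A.TransMonoid := (FreeMonoid.ofList w : FreeMonoid S)

/-- The function `f_w` of a class `[w]`. -/
noncomputable def clsProfile (A : NBA Q S) (c : A.TransMonoid) : Q → Q → Fin 3 :=
  Quotient.liftOn' c (fun w => A.profile w.toList) (fun _ _ h => h)

/-- There is a `w`-path from `q` to `q'` for a word `w` of the class `c`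
(equivalently, for every such word). -/
def ClsReach (A : NBA Q S) (q : Q) (c : A.TransMonoid) (q' : Q) : Prop :=
  ∃ w, A.cls w = c ∧ A.Reach q w q'

/-- There is an accepting `w`-path from `q` to `q'` for a word `w` of the class `c`
(equivalently, for every such word). -/
def ClsAccReach (A : NBA Q S) (q : Q) (c : A.TransMonoid) (q' : Q) : Prop :=
  ∃ w, A.cls w = c ∧ A.AccReach q w q'

theorem clsReach_cls (A : NBA Q S) (q : Q) (w : List S) (q' : Q) :
    A.ClsReach q (A.cls w) q' ↔ A.Reach q w q' := by
  refine ⟨?_, fun h => ⟨w, rfl, h⟩⟩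
  rintro ⟨u, hu, h⟩
  have hu : A.profile u = A.profile w := (Con.eq A.wordCon).1 hu
  exact ((A.profile_eq_iff u w).1 hu q q').1.1 h

theorem clsAccReach_cls (A : NBA Q S) (q : Q) (w : List S) (q' : Q) :
    A.ClsAccReach q (A.cls w) q' ↔ A.AccReach q w q' := by
  refine ⟨?_, fun h => ⟨w, rfl, h⟩⟩
  rintro ⟨u, hu, h⟩
  have hu : A.profile u = A.profile w := (Con.eq A.wordCon).1 hu
  exact ((A.profile_eq_iff u w).1 hu q q').2.1 h

/-! ### The continuous quotient game

The two automata of the game are `A` and the automaton that differs from `A` only in its initial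
state, which is then `q₀`. -/

/-- The configurations of the continuous quotient game. -/
inductive Pos (A : NBA Q S) : Type (max u v)
  /-- Refuter is to move; pebbles of Refuter and Prover on `q` and `q'`, abstract buffer `b`. -/
  | refuter (q q' : Q) (b : A.TransMonoid) : Pos A
  /-- Prover is to move, after Refuter has chosen the classes `c₁`, `c₂` and moved to `q`. -/
  | prover (q q' : Q) (b c₁ c₂ : A.TransMonoid) : Pos A

/-- The legal moves. -/
inductive Move (A : NBA Q S) : A.Pos → A.Pos → Prop
  | refuter {p q q' : Q} {b c₁ c₂ : A.TransMonoid} (h₁ : A.ClsReach p c₁ q)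
      (h₂ : A.ClsAccReach q c₂ q) (hc : IsIdempotentElem c₂) :
      Move A (.refuter p q' b) (.prover q q' b c₁ c₂)
  | prover {q p' q' : Q} {b c₁ c₂ : A.TransMonoid} (h₁ : A.ClsReach p' (b * c₁ * c₂) q')
      (h₂ : A.ClsAccReach q' c₂ q') :
      Move A (.prover q p' b c₁ c₂) (.refuter q q' c₂)

/-- It is Prover's turn. -/
def Pos.IsProver {A : NBA Q S} : A.Pos → Prop
  | .refuter .. => False
  | .prover .. => True

/-- The player whose turn it is is stuck. -/
def Stuck (A : NBA Q S) (x : A.Pos) : Prop := ∀ y, ¬ A.Move x y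

/-- The initial configuration. -/
def initPos (A : NBA Q S) (q₀ : Q) : A.Pos := .refuter A.start q₀ (A.cls [])

/-- A (maximal) play: a sequence of configurations along legal moves, which is infinite or ends in
a configuration where the player to move is stuck; `pos n = none` means that the play has ended
before step `n`. -/
structure Play (A : NBA Q S) (q₀ : Q) where
  pos : ℕ → Option A.Pos
  pos_zero : pos 0 = some (A.initPos q₀)
  move : ∀ n x y, pos n = some x → pos (n + 1) = some y → A.Move x y
  stuck : ∀ n x, pos n = some x → pos (n + 1) = none → A.Stuck x
  ended : ∀ n, pos n = none → pos (n + 1) = none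

/-- Prover wins the play if Refuter gets stuck or the play is infinitely long. -/
def Play.ProverWins {A : NBA Q S} {q₀ : Q} (π : A.Play q₀) : Prop :=
  (∃ n x, π.pos n = some x ∧ ¬ x.IsProver ∧ A.Stuck x) ∨ ∀ n, π.pos n ≠ none

/-- Refuter wins all other plays. -/
def Play.RefuterWins {A : NBA Q S} {q₀ : Q} (π : A.Play q₀) : Prop := ¬ π.ProverWins

/-- A strategy of Prover maps the past configurations and the current one to the next one; it
follows the rules whenever Prover is to move and not stuck. -/
structure ProverStrategy (A : NBA Q S) where
  next : List A.Pos → A.Pos → A.Pos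
  legal : ∀ h x, x.IsProver → ¬ A.Stuck x → A.Move x (next h x)

/-- Prover moves according to the strategy `σ` throughout the play. -/
def Play.Follows {A : NBA Q S} {q₀ : Q} (π : A.Play q₀) (σ : A.ProverStrategy) : Prop :=
  ∀ n x y, π.pos n = some x → x.IsProver → π.pos (n + 1) = some y →
    y = σ.next ((List.range n).filterMap π.pos) x

/-- Prover has a winning strategy for the continuous quotient game. -/
def ProverHasWinningStrategy (A : NBA Q S) (q₀ : Q) : Prop :=
  ∃ σ : A.ProverStrategy, ∀ π : A.Play q₀, π.Follows σ → π.ProverWins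

end NBA

/-! ### Exponential time -/

/-- `f` is computed, with respect to the given encodings of arguments and values, by a (multi-stack)
Turing machine in time `2 ^ p n` for some polynomial `p`, `n` being the length of the input. -/
def ComputableInExpTime {α β αΓ βΓ : Type} (ea : α → List αΓ) (eb : β → List βΓ)
    (f : α → β) : Prop :=
  ∃ (c : Turing.TM2ComputableInTime ea eb f) (p : Polynomial ℕ), ∀ n, c.time n ≤ 2 ^ p.eval n

open scoped Classical in
/-- The language `L` of bit strings belongs to EXPTIME. -/
def InEXPTIME (L : Set (List Bool)) : Prop :=
  ComputableInExpTime (fun x : List Bool => x) Computability.encodeBool (fun x => decide (x ∈ L))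

/-! ### Instances of the game as bit strings -/

/-- An instance: an automaton with states `0, …, n - 1` and letters `0, …, m - 1`, and a second
initial state. -/
structure Instance where
  n : ℕ
  m : ℕ
  aut : NBA (Fin n) (Fin m)
  start' : Fin n

/-- Unary code of a number. -/
def unary (k : ℕ) : List Bool := List.replicate k true ++ [false]

theorem unary_append_inj {j k : ℕ} {x y : List Bool} (h : unary j ++ x = unary k ++ y) :
    j = k ∧ x = y := by
  induction j generalizing k with
  | zero =>
    cases k with
    | zero => simpa [unary] using h
    | succ k => simp [unary, List.replicate_succ] at h
  | succ j ih =>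
    cases k with
    | zero => simp [unary, List.replicate_succ] at h
    | succ k =>
      have := @ih k (by simpa [unary, List.replicate_succ] using h)
      exact ⟨by rw [this.1], this.2⟩

theorem flatMap_inj {α β : Type} {l : List α} {k : ℕ} {f g : α → List β}
    (hf : ∀ a ∈ l, (f a).length = k) (hg : ∀ a ∈ l, (g a).length = k)
    (h : l.flatMap f = l.flatMap g) : ∀ a ∈ l, f a = g a := by
  induction l with
  | nil => simp
  | cons a l ih =>
    simp only [List.flatMap_cons, List.mem_cons, forall_eq_or_imp] at h hf hg ⊢
    obtain ⟨h1, h2⟩ := List.append_inj h (by rw [hf.1, hg.1])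
    exact ⟨h1, ih hf.2 hg.2 h2⟩

namespace Instance

open scoped Classical in
/-- Bit string of an instance: `n`, `m` and the two initial states in unary, the characteristic
vector of `F` and the table of `δ`. -/
noncomputable def encode (I : Instance) : List Bool :=
  unary I.n ++ (unary I.m ++ (unary I.aut.start ++ (unary I.start' ++
    ((List.finRange I.n).map (fun q => decide (q ∈ I.aut.F)) ++
      (List.finRange I.n).flatMap fun q => (List.finRange I.m).flatMap fun a =>
        (List.finRange I.n).map fun r => decide ((q, a, r) ∈ I.aut.δ)))))

/-- An instance is determined by its bit string. -/
theorem encode_injective : Function.Injective encode := by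
  rintro ⟨n, m, ⟨D, s, F⟩, s'⟩ ⟨n', m', ⟨D', t, F'⟩, t'⟩ h
  simp only [encode] at h
  obtain ⟨rfl, h⟩ := unary_append_inj h
  obtain ⟨rfl, h⟩ := unary_append_inj h
  obtain ⟨hs, h⟩ := unary_append_inj h
  obtain ⟨hs', h⟩ := unary_append_inj h
  obtain rfl := Fin.ext hs
  obtain rfl := Fin.ext hs'
  obtain ⟨hF, hD⟩ := List.append_inj h (by simp)
  have hF : F = F' := by
    ext q
    have := List.map_inj_left.1 hF q (List.mem_finRange q)
    simpa using this
  have hD : D = D' := by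
    ext ⟨q, a, r⟩
    have h1 := flatMap_inj (k := m * n) (by simp) (by simp) hD q (List.mem_finRange q)
    have h2 := flatMap_inj (k := n) (by simp) (by simp) h1 a (List.mem_finRange a)
    have h3 := List.map_inj_left.1 h2 r (List.mem_finRange r)
    simpa using h3
  rw [hF, hD]

/-- The bit strings of the instances for which Prover has a winning strategy. -/
def proverWinLanguage : Set (List Bool) :=
  {x | ∃ I : Instance, I.encode = x ∧ I.aut.ProverHasWinningStrategy I.start'}

/-- The table of a class, as a word: the values `f_w(q, q')` row by row, ended by the separator
`none`. -/
noncomputable def tableWord (I : Instance) (c : I.aut.TransMonoid) : List (Option (Fin 3)) :=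
  ((List.finRange I.n).flatMap fun q => (List.finRange I.n).map fun q' =>
    some (I.aut.clsProfile c q q')) ++ [none]

/-- The transition monoid, written out along a list of its elements: the tables of the elements in
the order of the list, a further separator, then the multiplication table, that is, the tables of
the products `c * d` for all pairs `(c, d)` of elements of the list in lexicographic order. -/
noncomputable def monoidWord (I : Instance) (l : List I.aut.TransMonoid) :
    List (Option (Fin 3)) :=
  l.flatMap I.tableWord ++ none :: l.flatMap fun c => l.flatMap fun d => I.tableWord (c * d)

/-- The transition monoid of an instance is computable in exponential time: for a suitable
enumeration of its elements without repetitions, the monoid written out along it is. -/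
def MonoidComputableInExpTime : Prop :=
  ∃ l : (I : Instance) → List I.aut.TransMonoid,
    (∀ I, (l I).Nodup ∧ ∀ c, c ∈ l I) ∧
    ComputableInExpTime encode (fun x : List (Option (Fin 3)) => x) (fun I => I.monoidWord (l I))

end Instance

end BuchiQuotient

/-!
Every claim reduces to elementary facts about a finite game, except that two of them are about
Turing machines, and most of the work is to get the obvious exponential algorithms down to that
level.

*Machines.* `Prog` is a small structured language for stack machines, and `Run.leads` shows that
its compilation to Mathlib's `TM2` machines is a step by step simulation. On top of it, `Ev C f`
says that `f` can be evaluated by such programs in time polynomial in a measure of size attached to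
the context `C`. The class of evaluable functions is closed under concatenation, case distinction,
concatenation over a range and iteration, hence under unary arithmetic, bounded quantifiers and
least fixed points of monotone operators on an initial segment of `ℕ` (`EvP.lfp`). As the measure
may be `2 ^ (n + 2) ^ 3` for inputs of length `n`, evaluable functions are computable in exponential
time (`computableInExpTime_of_ev`), although all numbers are held in unary. After that, an
algorithm is nothing but a formula with bounded quantifiers and least fixed points.

*The transition monoid.* A class of words on `n` states is given by the two relations "there is a
path" and "there is an accepting path", hence by a number below `cap n = 2 ^ (2 * n ^ 2)`, whose
binary digits are the entries of the relations. The codes of classes are those that arise from the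
code of the empty word by appending letters, which is a least fixed point (`lfp_memOp_iff`). Writing
out the tables of the relations and of their products along the list of these codes yields the
transition monoid (`Instance.monoidTable_encode`).

*The game.* `NBA.Lose` is the attractor of Refuter: it is the least set of configurations that
contains a configuration as soon as Refuter has a move after which every answer of Prover leads into
the set. Outside, Prover can stay outside as long as the play lasts; inside, Refuter can follow an
induction along `Lose` until Prover is stuck, against strategies that may depend on the past
(`NBA.proverHasWinningStrategy_iff`). On codes the attractor is again a least fixed point
(`lfp_loseOp_iff`). Together with a recognition of the bit strings that are codes of instances
(`exists_encode_iff`) this gives the decision procedure.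

*The arena.* A class is determined by a function `Q² → {0, 1, 2}`, so that there are at most
`3 ^ |Q|²` classes and `|Q|² (3 ^ |Q|² + 3 ^ (3 |Q|²))` configurations (`NBA.card_pos_le`). Refuter
wins exactly the plays with a last configuration that belongs to Prover
(`NBA.Play.refuterWins_iff`).
-/

namespace BuchiQuotient

/-! ### A structured language for stack machines -/

/-- Structured programs over Boolean registers (stacks) numbered by `ℕ`, with an additional
write-only output stack over the alphabet `G`. -/
inductive Prog (G : Type) : Type
  | skip : Prog G
  /-- push `b` on register `k` -/
  | push (k : ℕ) (b : Bool) : Prog G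
  /-- remove the top of register `k`, if there is one -/
  | pop (k : ℕ) : Prog G
  /-- push `a` on the output stack -/
  | emit (a : G) : Prog G
  | seq (P Q : Prog G) : Prog G
  /-- run `P` if the top of register `k` is `true`; run `Q` if it is `false` or missing -/
  | ite (k : ℕ) (P Q : Prog G) : Prog G
  /-- run `P` as long as register `k` is nonempty -/
  | loop (k : ℕ) (P : Prog G) : Prog G

/-- The store of a program: the contents of the registers and of the output stack, tops first. -/
@[ext] structure Store (G : Type) where
  reg : ℕ → List Bool
  out : List G

namespace Store

variable {G : Type}

/-- Overwrite register `k`. -/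
def set (s : Store G) (k : ℕ) (l : List Bool) : Store G :=
  { s with reg := Function.update s.reg k l }

@[simp] theorem set_out (s : Store G) (k : ℕ) (l : List Bool) : (s.set k l).out = s.out := rfl

@[simp] theorem set_reg_self (s : Store G) (k : ℕ) (l : List Bool) : (s.set k l).reg k = l := by
  simp [set]

theorem set_reg (s : Store G) (k : ℕ) (l : List Bool) (j : ℕ) :
    (s.set k l).reg j = if j = k then l else s.reg j := by
  simp [set, Function.update_apply]

@[simp] theorem set_reg_of_ne (s : Store G) {k j : ℕ} (l : List Bool) (h : j ≠ k) :
    (s.set k l).reg j = s.reg j := by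
  simp [set_reg, h]

@[simp] theorem set_set (s : Store G) (k : ℕ) (l l' : List Bool) :
    (s.set k l).set k l' = s.set k l' := by
  simp [set]

theorem set_eq_self (s : Store G) {k : ℕ} {l : List Bool} (h : s.reg k = l) : s.set k l = s := by
  subst h; simp [set]

end Store

namespace Prog

variable {G : Type}

/-- `Run P s t s'`: started in `s`, the program `P` ends in `s'` after exactly `t` steps. -/
inductive Run : Prog G → Store G → ℕ → Store G → Prop
  | skip (s) : Run .skip s 1 s
  | push (k b s) : Run (.push k b) s 1 (s.set k (b :: s.reg k))
  | pop (k s) : Run (.pop k) s 1 (s.set k (s.reg k).tail)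
  | emit (a s) : Run (.emit a) s 1 { s with out := a :: s.out }
  | seq {P Q s t s' t' s''} : Run P s t s' → Run Q s' t' s'' → Run (.seq P Q) s (t + t') s''
  | ite_true {k P Q s t s'} : (s.reg k).head? = some true → Run P s t s' →
      Run (.ite k P Q) s (t + 1) s'
  | ite_false {k P Q s t s'} : (s.reg k).head? ≠ some true → Run Q s t s' →
      Run (.ite k P Q) s (t + 1) s'
  | loop_nil {k P s} : s.reg k = [] → Run (.loop k P) s 1 s
  | loop_cons {k P s t s' t' s''} : s.reg k ≠ [] → Run P s t s' → Run (.loop k P) s' t' s'' →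
      Run (.loop k P) s (t + t' + 1) s''

/-! ### Compilation to Turing machines -/

/-- The labels of the machine code of a program. -/
@[reducible] def Lab : Prog G → Type
  | seq P Q => P.Lab ⊕ Q.Lab
  | ite _ P Q => Option (P.Lab ⊕ Q.Lab)
  | loop _ P => Option P.Lab
  | skip | push _ _ | pop _ | emit _ => Unit

/-- The label at which the execution of a program starts. -/
def entry : (P : Prog G) → P.Lab
  | seq P _ => Sum.inl P.entry
  | ite _ _ _ => (none : Option _)
  | loop _ _ => (none : Option _)
  | skip | push _ _ | pop _ | emit _ => ()

/-- Programs have finitely many labels. -/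
@[reducible] def labFintype : (P : Prog G) → Fintype P.Lab
  | seq P Q =>
    have := P.labFintype
    have := Q.labFintype
    inferInstanceAs (Fintype (P.Lab ⊕ Q.Lab))
  | ite _ P Q =>
    have := P.labFintype
    have := Q.labFintype
    inferInstanceAs (Fintype (Option (P.Lab ⊕ Q.Lab)))
  | loop _ P =>
    have := P.labFintype
    inferInstanceAs (Fintype (Option P.Lab))
  | skip => inferInstanceAs (Fintype Unit)
  | push _ _ => inferInstanceAs (Fintype Unit)
  | pop _ => inferInstanceAs (Fintype Unit)
  | emit _ => inferInstanceAs (Fintype Unit)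

/-- A bound for the registers occurring in a program. -/
def maxReg : Prog G → ℕ
  | seq P Q => max P.maxReg Q.maxReg
  | ite k P Q => max k (max P.maxReg Q.maxReg)
  | loop k P => max k P.maxReg
  | push k _ => k
  | pop k => k
  | skip => 0
  | emit _ => 0

/-- The stack alphabets: the output stack is `none`, the registers are `some 0, …, some B`. -/
@[reducible] def Alph (G : Type) (B : ℕ) : Option (Fin (B + 1)) → Type
  | none => G
  | some _ => Bool

/-- The stack holding register `k`. -/
abbrev stack (B k : ℕ) : Option (Fin (B + 1)) := some (Fin.ofNat (B + 1) k)

/-- The machine code of a program, with its labels embedded by `emb` into those of a larger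
program, in which execution is to continue at `exit`. The internal state of the machine serves only
to branch on the top of a stack. -/
def code (B : ℕ) {L : Type} :
    (P : Prog G) → (P.Lab → L) → L → P.Lab → Turing.TM2.Stmt (Alph G B) L (Option Bool)
  | skip, _, exit, _ => .goto fun _ => exit
  | push k b, _, exit, _ => .push (stack B k) (fun _ => (b : Bool)) (.goto fun _ => exit)
  | pop k, _, exit, _ => .pop (stack B k) (fun _ (x : Option Bool) => x) (.goto fun _ => exit)
  | emit a, _, exit, _ => .push none (fun _ => (a : G)) (.goto fun _ => exit)
  | seq P Q, emb, exit, l =>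
    Sum.elim (P.code B (fun x => emb (Sum.inl x)) (emb (Sum.inr Q.entry)))
      (Q.code B (fun x => emb (Sum.inr x)) exit) l
  | ite k P Q, emb, exit, l =>
    Option.elim l
      (.peek (stack B k) (fun _ (x : Option Bool) => x) (.goto fun v =>
        if v = some true then emb (some (Sum.inl P.entry)) else emb (some (Sum.inr Q.entry))))
      (Sum.elim (P.code B (fun x => emb (some (Sum.inl x))) exit)
        (Q.code B (fun x => emb (some (Sum.inr x))) exit))
  | loop k P, emb, exit, l =>
    Option.elim l
      (.peek (stack B k) (fun _ (x : Option Bool) => x) (.goto fun v =>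
        if v.isSome then emb (some P.entry) else exit))
      (P.code B (fun x => emb (some x)) (emb none))

/-- The stacks of the machine that represent a store. -/
def toStk (B : ℕ) (s : Store G) : (k : Option (Fin (B + 1))) → List (Alph G B k)
  | none => s.out
  | some i => s.reg i

theorem toStk_stack {B k : ℕ} (s : Store G) (hk : k ≤ B) :
    toStk B s (stack B k) = s.reg k :=
  congrArg s.reg (Nat.mod_eq_of_lt (Nat.lt_succ_of_le hk))

theorem update_toStk_some {B : ℕ} (s : Store G) (i : Fin (B + 1)) (l : List Bool) :
    Function.update (toStk B s) (some i) l = toStk B (s.set i l) := by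
  funext j
  rcases j with _ | j
  · exact Function.update_of_ne (by simp) _ _
  · by_cases h : j = i
    · subst h
      exact (Function.update_self _ _ _).trans (s.set_reg_self _ _).symm
    · exact (Function.update_of_ne (by simpa using h) _ _).trans
        (s.set_reg_of_ne _ (by simpa [Fin.ext_iff] using h)).symm

theorem update_toStk {B k : ℕ} (s : Store G) (hk : k ≤ B) (l : List Bool) :
    Function.update (toStk B s) (stack B k) l = toStk B (s.set k l) :=
  (update_toStk_some s _ l).trans
    (congrArg (fun j => toStk B (s.set j l)) (Nat.mod_eq_of_lt (Nat.lt_succ_of_le hk)))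

theorem update_toStk_none {B : ℕ} (s : Store G) (o : List G) :
    Function.update (toStk B s) none o = toStk B { s with out := o } := by
  funext j
  rcases j with _ | j
  · exact Function.update_self _ _ _
  · exact Function.update_of_ne (by simp) _ _

/-- In exactly `t` steps the machine with code `M` gets from label `l` and store `s` to
`l'` and `s'`, whatever its internal state is. -/
def Leads {B : ℕ} {L : Type} (M : L → Turing.TM2.Stmt (Alph G B) L (Option Bool))
    (l : L) (s : Store G) (t : ℕ) (l' : L) (s' : Store G) : Prop :=
  ∀ v, ∃ v', (flip bind (Turing.TM2.step M))^[t] (some ⟨some l, v, toStk B s⟩) =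
    some ⟨some l', v', toStk B s'⟩

theorem Leads.trans {B : ℕ} {L : Type} {M : L → Turing.TM2.Stmt (Alph G B) L (Option Bool)}
    {l l' l'' : L} {s s' s'' : Store G} {t t' : ℕ} (h : Leads M l s t l' s')
    (h' : Leads M l' s' t' l'' s'') : Leads M l s (t + t') l'' s'' := by
  intro v
  obtain ⟨v', e⟩ := h v
  obtain ⟨v'', e'⟩ := h' v'
  refine ⟨v'', ?_⟩
  rw [show t + t' = t' + t from add_comm _ _, Function.iterate_add_apply, e, e']

theorem Leads.single {B : ℕ} {L : Type} {M : L → Turing.TM2.Stmt (Alph G B) L (Option Bool)}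
    {l l' : L} {s s' : Store G} {c : Turing.TM2.Stmt (Alph G B) L (Option Bool)} (hl : M l = c)
    (h : ∀ v, ∃ v', Turing.TM2.stepAux c v (toStk B s) = ⟨some l', v', toStk B s'⟩) :
    Leads M l s 1 l' s' := by
  subst hl
  intro v
  obtain ⟨v', e⟩ := h v
  exact ⟨v', congrArg some e⟩

/-- A step that branches on the top of a stack. -/
theorem Leads.peek {B k : ℕ} {L : Type} {M : L → Turing.TM2.Stmt (Alph G B) L (Option Bool)}
    {l l' : L} {s : Store G} (hk : k ≤ B) {f : Option Bool → L}
    (hl : M l = .peek (stack B k) (fun _ (x : Option Bool) => x) (.goto f))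
    (h : f (s.reg k).head? = l') : Leads M l s 1 l' s := by
  subst h
  refine Leads.single hl fun v => ⟨(s.reg k).head?, ?_⟩
  exact congrArg (fun r : List Bool => Turing.TM2.Cfg.mk (some (f r.head?)) r.head? (toStk B s))
    (toStk_stack s hk)

/-- The machine code of a program simulates it step by step. -/
theorem Run.leads {B : ℕ} {L : Type} {M : L → Turing.TM2.Stmt (Alph G B) L (Option Bool)}
    {P : Prog G} {s s' : Store G} {t : ℕ} (h : Run P s t s') (hB : P.maxReg ≤ B)
    (emb : P.Lab → L) (exit : L) (hM : ∀ l, M (emb l) = P.code B emb exit l) :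
    Leads M (emb P.entry) s t exit s' := by
  induction h generalizing exit with
  | skip s => exact Leads.single (hM ()) fun v => ⟨v, rfl⟩
  | push k b s =>
    refine Leads.single (hM ()) fun v => ⟨v, ?_⟩
    refine congrArg (Turing.TM2.Cfg.mk (some exit) v) ?_
    exact (congrArg (fun r : List Bool => Function.update (toStk B s) (stack B k) (b :: r))
      (toStk_stack s hB)).trans (update_toStk s hB _)
  | pop k s =>
    refine Leads.single (hM ()) fun v => ⟨(s.reg k).head?, ?_⟩
    refine (congrArg (fun r : List Bool => Turing.TM2.Cfg.mk (some exit) r.head?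
      (Function.update (toStk B s) (stack B k) r.tail)) (toStk_stack s hB)).trans ?_
    exact congrArg (Turing.TM2.Cfg.mk (some exit) _) (update_toStk s hB _)
  | emit a s =>
    refine Leads.single (hM ()) fun v => ⟨v, ?_⟩
    exact congrArg (Turing.TM2.Cfg.mk (some exit) v) (update_toStk_none s _)
  | @seq P Q s t s' t' s'' _ _ ih ih' =>
    have h1 := ih (le_trans (le_max_left _ _) hB) (fun x => emb (Sum.inl x))
      (emb (Sum.inr Q.entry)) (fun l => hM (Sum.inl l))
    have h2 := ih' (le_trans (le_max_right _ _) hB) (fun x => emb (Sum.inr x)) exit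
      (fun l => hM (Sum.inr l))
    exact h1.trans h2
  | @ite_true k P Q s t s' hk _ ih =>
    have h1 := ih (le_trans (le_trans (le_max_left _ _) (le_max_right _ _)) hB)
      (fun x => emb (some (Sum.inl x))) exit (fun l => hM (some (Sum.inl l)))
    have h0 : Leads M (emb none) s 1 (emb (some (Sum.inl P.entry))) s :=
      Leads.peek (le_trans (le_max_left _ _) hB) (hM none) (if_pos hk)
    rw [add_comm]
    exact h0.trans h1
  | @ite_false k P Q s t s' hk _ ih =>
    have h1 := ih (le_trans (le_trans (le_max_right _ _) (le_max_right _ _)) hB)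
      (fun x => emb (some (Sum.inr x))) exit (fun l => hM (some (Sum.inr l)))
    have h0 : Leads M (emb none) s 1 (emb (some (Sum.inr Q.entry))) s :=
      Leads.peek (le_trans (le_max_left _ _) hB) (hM none) (if_neg hk)
    rw [add_comm]
    exact h0.trans h1
  | @loop_nil k P s hk =>
    exact Leads.peek (le_trans (le_max_left _ _) hB) (hM none) (if_neg (by simp [hk]))
  | @loop_cons k P s t s' t' s'' hk _ _ ih ih' =>
    have h1 := ih (le_trans (le_max_right _ _) hB)
      (fun x => emb (some x)) (emb none) (fun l => hM (some l))
    have h2 := ih' hB emb exit hM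
    have h0 : Leads M (emb none) s 1 (emb (some P.entry)) s :=
      Leads.peek (le_trans (le_max_left _ _) hB) (hM none)
        (if_pos (by rwa [List.isSome_head?]))
    rw [add_comm]
    exact h0.trans (h1.trans h2)

/-- The Turing machine of a program. The input is in register `0`. -/
def machine [Fintype G] (P : Prog G) : Turing.FinTM2 where
  K := Option (Fin (P.maxReg + 1))
  k₀ := stack P.maxReg 0
  k₁ := none
  Γ := Alph G P.maxReg
  Λ := Option P.Lab
  main := some P.entry
  ΛFin := have := P.labFintype; inferInstance
  σ := Option Bool
  initialState := none
  Γk₀Fin := inferInstanceAs (Fintype Bool)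
  m := fun l => l.elim (.load (fun _ => none) .halt) (P.code P.maxReg some none)

/-- The machine of a program ends in Mathlib's halting configuration, provided that the program
leaves all its registers empty. -/
theorem Run.outputs [Fintype G] {P : Prog G} {x : List Bool} {o : List G} {t : ℕ}
    (h : Run P ⟨Function.update (fun _ => []) 0 x, []⟩ t ⟨fun _ => [], o⟩) :
    (flip bind P.machine.step)^[t + 1] (some (Turing.initList P.machine x)) =
      some (Turing.haltList P.machine o) := by
  have hl := h.leads (M := P.machine.m) le_rfl some none (fun _ => rfl)
  obtain ⟨v, hv⟩ := hl none
  have hi : Turing.initList P.machine x = ⟨some (some P.entry), none,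
      toStk P.maxReg ⟨Function.update (fun _ => []) 0 x, ([] : List G)⟩⟩ := by
    unfold Turing.initList
    congr 1
    funext k
    rcases k with _ | i
    · rfl
    · by_cases hi : i = 0
      · subst hi; rfl
      · rw [dif_neg]
        · have : (i : ℕ) ≠ 0 := fun h => hi (Fin.ext h)
          simp [toStk, this]; rfl
        · intro h
          apply hi
          injection h
  have ho : Turing.haltList P.machine o = ⟨none, none, toStk P.maxReg ⟨fun _ => [], o⟩⟩ := by
    unfold Turing.haltList
    congr 1
    funext k
    rcases k with _ | i <;> rfl
  rw [hi, ho, Function.iterate_succ_apply']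
  refine (congrArg (fun c => flip bind P.machine.step c) hv).trans ?_
  rfl

/-- A function is computable in time `T + 1` if a program turns the input in register `0` into the
value on the output stack in time `T`; the additional step is the one that halts. -/
theorem Run.computableInTime [Fintype G] {α β : Type} {ea : α → List Bool} {eb : β → List G}
    {f : α → β} (P : Prog G) (T : ℕ → ℕ)
    (h : ∀ a, ∃ t ≤ T (ea a).length,
      Run P ⟨Function.update (fun _ => []) 0 (ea a), []⟩ t ⟨fun _ => [], eb (f a)⟩) :
    ∃ c : Turing.TM2ComputableInTime ea eb f, c.time = fun n => T n + 1 := by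
  refine ⟨{ tm := P.machine, inputAlphabet := Equiv.refl _, outputAlphabet := Equiv.refl _,
            time := fun n => T n + 1, outputsFun := fun a =>
              { steps := (h a).choose + 1, evals_in_steps := ?_, steps_le_m := ?_ } }, rfl⟩
  · have := (h a).choose_spec.2.outputs
    have e1 : List.map (Equiv.refl Bool).invFun (ea a) = ea a := List.map_id _
    have e2 : List.map (Equiv.refl G).invFun (eb (f a)) = eb (f a) := List.map_id _
    refine Eq.trans ?_ (this.trans (congrArg (fun l => some (Turing.haltList P.machine l)) e2).symm)
    exact congrArg (fun l => (flip bind P.machine.step)^[_] (some (Turing.initList P.machine l))) e1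
  · exact Nat.succ_le_succ (h a).choose_spec.1

end Prog

end BuchiQuotient

namespace BuchiQuotient

namespace Prog

variable {G : Type}

/-! ### Basic routines on registers -/

/-- Started in `s`, the program ends in `s'` after at most `T` steps. -/
def RunsTo (P : Prog G) (s : Store G) (T : ℕ) (s' : Store G) : Prop := ∃ t ≤ T, Run P s t s'

theorem RunsTo.mono {P : Prog G} {s s' : Store G} {T T' : ℕ} (h : P.RunsTo s T s')
    (hT : T ≤ T') : P.RunsTo s T' s' :=
  let ⟨t, ht, hr⟩ := h
  ⟨t, ht.trans hT, hr⟩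

theorem RunsTo.of_eq {P : Prog G} {s s' s'' : Store G} {T T' : ℕ} (h : P.RunsTo s T s')
    (hs : s' = s'') (hT : T ≤ T') : P.RunsTo s T' s'' :=
  hs ▸ h.mono hT

theorem RunsTo.seq {P Q : Prog G} {s s' s'' : Store G} {T T' : ℕ} (h : P.RunsTo s T s')
    (h' : Q.RunsTo s' T' s'') : (Prog.seq P Q).RunsTo s (T + T') s'' :=
  let ⟨t, ht, hr⟩ := h
  let ⟨t', ht', hr'⟩ := h'
  ⟨t + t', add_le_add ht ht', hr.seq hr'⟩

theorem runsTo_skip (s : Store G) : (skip : Prog G).RunsTo s 1 s := ⟨1, le_rfl, .skip s⟩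

theorem runsTo_push (k : ℕ) (b : Bool) (s : Store G) :
    (push k b).RunsTo s 1 (s.set k (b :: s.reg k)) := ⟨1, le_rfl, .push k b s⟩

theorem runsTo_pop (k : ℕ) (s : Store G) :
    (pop k).RunsTo s 1 (s.set k (s.reg k).tail) := ⟨1, le_rfl, .pop k s⟩

theorem runsTo_emit (a : G) (s : Store G) :
    (emit a).RunsTo s 1 { s with out := a :: s.out } := ⟨1, le_rfl, .emit a s⟩

theorem RunsTo.ite {P Q : Prog G} {k : ℕ} {s s' : Store G} {T : ℕ}
    (h : (s.reg k).head? = some true → P.RunsTo s T s')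
    (h' : (s.reg k).head? ≠ some true → Q.RunsTo s T s') : (ite k P Q).RunsTo s (T + 1) s' := by
  by_cases hk : (s.reg k).head? = some true
  · obtain ⟨t, ht, hr⟩ := h hk
    exact ⟨t + 1, by omega, hr.ite_true hk⟩
  · obtain ⟨t, ht, hr⟩ := h' hk
    exact ⟨t + 1, by omega, hr.ite_false hk⟩

theorem RunsTo.loop_cons {P : Prog G} {k : ℕ} {s s' s'' : Store G} {T T' : ℕ}
    (hk : s.reg k ≠ []) (h : P.RunsTo s T s') (h' : (loop k P).RunsTo s' T' s'') :
    (loop k P).RunsTo s (T + T' + 1) s'' :=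
  let ⟨t, ht, hr⟩ := h
  let ⟨t', ht', hr'⟩ := h'
  ⟨t + t' + 1, by omega, .loop_cons hk hr hr'⟩

/-- A loop that takes one entry off its control register in each round. -/
theorem runsTo_loop {P : Prog G} {k T : ℕ} (st : ℕ → Store G) (n : ℕ)
    (hk : ∀ i ≤ n, ((st i).reg k).length = i) (h : ∀ i < n, P.RunsTo (st (i + 1)) T (st i)) :
    (loop k P).RunsTo (st n) (n * (T + 1) + 1) (st 0) := by
  induction n with
  | zero => exact ⟨1, by omega, .loop_nil (List.length_eq_zero_iff.1 (hk 0 le_rfl))⟩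
  | succ n ih =>
    have hne : (st (n + 1)).reg k ≠ [] := by
      intro e
      have := hk (n + 1) le_rfl
      simp [e] at this
    refine (RunsTo.loop_cons hne (h n (by omega))
      (ih (fun i hi => hk i (by omega)) fun i hi => h i (by omega))).mono ?_
    rw [Nat.succ_mul]; omega

/-- Empty register `k`. -/
def clear (k : ℕ) : Prog G := loop k (pop k)

theorem runsTo_clear (k : ℕ) (s : Store G) :
    (clear k).RunsTo s (2 * (s.reg k).length + 1) (s.set k []) := by
  generalize hl : s.reg k = l
  induction l generalizing s with
  | nil => rw [s.set_eq_self hl]; exact ⟨1, by omega, .loop_nil hl⟩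
  | cons a l ih =>
    have := ih (s.set k (s.reg k).tail) (by simp [hl])
    rw [Store.set_set] at this
    refine (RunsTo.loop_cons (by simp [hl]) (runsTo_pop k s) this).mono ?_
    simp only [List.length_cons]; omega

/-- Move the contents of register `k` to register `j`, reversing their order. -/
def move (k j : ℕ) : Prog G :=
  loop k (ite k (seq (pop k) (push j true)) (seq (pop k) (push j false)))

theorem runsTo_move {k j : ℕ} (hkj : j ≠ k) (s : Store G) :
    (move k j).RunsTo s (4 * (s.reg k).length + 1)
      ((s.set j ((s.reg k).reverse ++ s.reg j)).set k []) := by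
  generalize hl : s.reg k = l
  induction l generalizing s with
  | nil =>
    refine ⟨1, by omega, ?_⟩
    rw [Store.set_eq_self _ (l := []) (by simp [hl, hkj.symm]), s.set_eq_self (by simp)]
    exact .loop_nil hl
  | cons a l ih =>
    have h := ih ((s.set k l).set j (a :: s.reg j)) (by simp [hkj.symm])
    have hb : (ite k (seq (pop k) (push j true)) (seq (pop k) (push j false))).RunsTo s 3
        ((s.set k l).set j (a :: s.reg j)) := by
      have h1 := runsTo_pop (G := G) k s
      have h2 := fun b => runsTo_push (G := G) j b (s.set k l)
      simp only [hl, List.tail_cons] at h1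
      simp only [s.set_reg_of_ne l hkj] at h2
      refine RunsTo.ite (T := 2) (fun e => ?_) fun e => ?_
      · obtain rfl : a = true := by simpa [hl] using e
        exact h1.seq (h2 _)
      · obtain rfl : a = false := by simpa [hl] using e
        exact h1.seq (h2 _)
    have e : ((s.set j ((a :: l).reverse ++ s.reg j)).set k []) =
        ((((s.set k l).set j (a :: s.reg j)).set j
          (l.reverse ++ ((s.set k l).set j (a :: s.reg j)).reg j)).set k []) := by
      refine Store.ext (funext fun i => ?_) rfl
      simp only [Store.set_reg]
      split_ifs <;> simp
    rw [e]
    refine (RunsTo.loop_cons (by simp [hl]) hb h).mono ?_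
    simp only [List.length_cons]; omega

/-- Move the contents of register `l` to both registers `k` and `j`, reversing their order. -/
def moveBoth (l k j : ℕ) : Prog G :=
  loop l (ite l (seq (pop l) (seq (push k true) (push j true)))
    (seq (pop l) (seq (push k false) (push j false))))

theorem runsTo_moveBoth {l k j : ℕ} (hkj : j ≠ k) (hlk : k ≠ l) (hlj : j ≠ l) (s : Store G) :
    (moveBoth l k j).RunsTo s (5 * (s.reg l).length + 1)
      (((s.set k ((s.reg l).reverse ++ s.reg k)).set j ((s.reg l).reverse ++ s.reg j)).set l
        []) := by
  generalize hv : s.reg l = v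
  induction v generalizing s with
  | nil =>
    refine ⟨1, by omega, ?_⟩
    rw [Store.set_eq_self _ (l := []) (by simp [hv, hlk.symm, hlj.symm]),
      Store.set_eq_self _ (by simp [hkj]), Store.set_eq_self _ (by simp)]
    exact .loop_nil hv
  | cons a v ih =>
    have h := ih (((s.set l v).set k (a :: s.reg k)).set j (a :: s.reg j))
      (by simp [hlj.symm, hlk.symm])
    have hb : (ite l (seq (pop l) (seq (push k true) (push j true)))
        (seq (pop l) (seq (push k false) (push j false)))).RunsTo s 4
        (((s.set l v).set k (a :: s.reg k)).set j (a :: s.reg j)) := by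
      have h1 := runsTo_pop (G := G) l s
      have h2 := fun b => runsTo_push (G := G) k b (s.set l v)
      have h3 := fun b => runsTo_push (G := G) j b ((s.set l v).set k (b :: s.reg k))
      simp only [hv, List.tail_cons] at h1
      simp only [s.set_reg_of_ne v hlk] at h2
      simp only [Store.set_reg_of_ne _ _ hkj, Store.set_reg_of_ne _ _ hlj] at h3
      refine RunsTo.ite (T := 3) (fun e => ?_) fun e => ?_
      · obtain rfl : a = true := by simpa [hv] using e
        exact h1.seq ((h2 _).seq (h3 _))
      · obtain rfl : a = false := by simpa [hv] using e
        exact h1.seq ((h2 _).seq (h3 _))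
    have hfin := RunsTo.loop_cons (by simp [hv]) hb h
    refine hfin.of_eq (Store.ext (funext fun i => ?_) rfl) ?_
    · simp only [Store.set_reg]
      split_ifs <;> simp_all
    · simp only [List.length_cons]; omega

/-- Copy register `k` to the empty register `j`, with the empty register `l` as scratch space. -/
def copy (k j l : ℕ) : Prog G := seq (move k l) (moveBoth l k j)

theorem runsTo_copy {k j l : ℕ} (hkj : j ≠ k) (hlk : k ≠ l) (hlj : j ≠ l) (s : Store G)
    (hl : s.reg l = []) (hj : s.reg j = []) :
    (copy k j l).RunsTo s (9 * (s.reg k).length + 2) (s.set j (s.reg k)) := by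
  have h := (runsTo_move hlk.symm s).seq (runsTo_moveBoth hkj hlk hlj _)
  refine h.of_eq (Store.ext (funext fun i => ?_) rfl) ?_
  · simp only [Store.set_reg]
    split_ifs <;> simp_all
  · simp [hlk.symm, hl]; omega

/-- Move the contents of register `k` onto register `j`, with the empty register `l` as scratch
space. -/
def shift (k j l : ℕ) : Prog G := seq (move k l) (move l j)

theorem runsTo_shift {k j l : ℕ} (hkj : j ≠ k) (hlk : k ≠ l) (hlj : j ≠ l) (s : Store G)
    (hl : s.reg l = []) :
    (shift k j l).RunsTo s (8 * (s.reg k).length + 2)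
      ((s.set j (s.reg k ++ s.reg j)).set k []) := by
  have h := (runsTo_move hlk.symm s).seq (runsTo_move hlj _)
  refine h.of_eq (Store.ext (funext fun i => ?_) rfl) ?_
  · simp only [Store.set_reg]
    split_ifs <;> simp_all
  · simp [hlk.symm, hl]; omega

end Prog

/-! ### Evaluable functions -/

/-- Unary notation for a number in a register. -/
def un (n : ℕ) : List Bool := List.replicate n true

@[simp] theorem length_un (n : ℕ) : (un n).length = n := by simp [un]

/-- A context: values `x : α` are given by the contents of finitely many registers, and sizes are
measured by `μ x`. -/
structure Ctx (α : Type) where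
  /-- the contents of the registers -/
  lay : α → List (List Bool)
  /-- the measure of size -/
  μ : α → ℕ
  /-- sums and constants are to be bounded by powers of the measure -/
  two_le : ∀ x, 2 ≤ μ x
  length_le : ∀ x, ∀ l ∈ lay x, l.length ≤ μ x

namespace Ctx

variable {α : Type}

/-- The context extended by a number, held in unary. -/
def num (C : Ctx α) : Ctx (α × ℕ) where
  lay y := un y.2 :: C.lay y.1
  μ y := C.μ y.1 + y.2
  two_le y := le_add_right (C.two_le y.1)
  length_le y l hl := by
    rcases List.mem_cons.1 hl with rfl | hl
    · simp
    · exact le_add_right (C.length_le y.1 l hl)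

/-- The context extended by a list. -/
def arr (C : Ctx α) : Ctx (α × List Bool) where
  lay y := y.2 :: C.lay y.1
  μ y := C.μ y.1 + y.2.length
  two_le y := le_add_right (C.two_le y.1)
  length_le y l hl := by
    rcases List.mem_cons.1 hl with rfl | hl
    · simp
    · exact le_add_right (C.length_le y.1 l hl)

/-- `g` is polynomially bounded in terms of the measure of the context. -/
def Poly (C : Ctx α) (g : α → ℕ) : Prop := ∃ d, ∀ x, g x ≤ C.μ x ^ d

variable {C : Ctx α}

theorem Poly.mono {g h : α → ℕ} (hg : C.Poly g) (hle : ∀ x, h x ≤ g x) : C.Poly h :=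
  let ⟨d, hd⟩ := hg
  ⟨d, fun x => (hle x).trans (hd x)⟩

theorem Poly.const (k : ℕ) : C.Poly fun _ => k :=
  ⟨k, fun x => (Nat.lt_two_pow_self (n := k)).le.trans (Nat.pow_le_pow_left (C.two_le x) k)⟩

theorem Poly.add {g h : α → ℕ} (hg : C.Poly g) (hh : C.Poly h) : C.Poly fun x => g x + h x := by
  obtain ⟨a, ha⟩ := hg
  obtain ⟨b, hb⟩ := hh
  refine ⟨max a b + 1, fun x => ?_⟩
  have h2 := C.two_le x
  have h1 : g x ≤ C.μ x ^ max a b :=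
    (ha x).trans (Nat.pow_le_pow_right (by omega) (le_max_left _ _))
  have h1' : h x ≤ C.μ x ^ max a b :=
    (hb x).trans (Nat.pow_le_pow_right (by omega) (le_max_right _ _))
  calc g x + h x ≤ C.μ x ^ max a b * 2 := by omega
    _ ≤ C.μ x ^ max a b * C.μ x := Nat.mul_le_mul_left _ h2
    _ = _ := (pow_succ _ _).symm

theorem Poly.mul {g h : α → ℕ} (hg : C.Poly g) (hh : C.Poly h) : C.Poly fun x => g x * h x := by
  obtain ⟨a, ha⟩ := hg
  obtain ⟨b, hb⟩ := hh
  exact ⟨a + b, fun x => (Nat.mul_le_mul (ha x) (hb x)).trans (pow_add _ _ _).ge⟩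

/-- A polynomial bound in an extended context is uniform in the new variable, as long as that
variable has polynomial size. -/
theorem Poly.of_extension {β : Type} {D : Ctx (α × β)} {sz : β → ℕ}
    (hD : ∀ y, D.μ y = C.μ y.1 + sz y.2) {g : α × β → ℕ} {n : α → ℕ} (hg : D.Poly g)
    (hn : C.Poly n) : ∃ h, C.Poly h ∧ ∀ x i, sz i ≤ n x → g (x, i) ≤ h x := by
  obtain ⟨d, hd⟩ := hg
  have h0 : C.Poly C.μ := ⟨1, fun x => by simp⟩
  obtain ⟨e, he⟩ := h0.add hn
  refine ⟨fun x => C.μ x ^ (e * d), ⟨e * d, fun x => le_rfl⟩, fun x i hi => (hd _).trans ?_⟩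
  simp only [pow_mul, hD]
  exact Nat.pow_le_pow_left (le_trans (by simpa using hi) (he x)) d

theorem Poly.num {g : α × ℕ → ℕ} {n : α → ℕ} (hg : C.num.Poly g) (hn : C.Poly n) :
    ∃ h, C.Poly h ∧ ∀ x i, i ≤ n x → g (x, i) ≤ h x :=
  Poly.of_extension (D := C.num) (sz := id) (fun _ => rfl) hg hn

theorem Poly.arr {g : α × List Bool → ℕ} {n : α → ℕ} (hg : C.arr.Poly g) (hn : C.Poly n) :
    ∃ h, C.Poly h ∧ ∀ x (l : List Bool), l.length ≤ n x → g (x, l) ≤ h x :=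
  Poly.of_extension (D := C.arr) (sz := List.length) (fun _ => rfl) hg hn

end Ctx

open Prog

/-- `f` can be evaluated in time polynomial in the measure of the context (which may itself be
exponential in the length of the input): whatever registers `r` the variables are held in, and
whatever the register `b` above them is from which on all registers are empty, there is a program
that writes `f x` to register `b` and leaves the rest of the store as it was. -/
def Ev {α : Type} (C : Ctx α) (f : α → List Bool) : Prop :=
  C.Poly (fun x => (f x).length) ∧ ∃ T, C.Poly T ∧ ∀ (G : Type) (r : List ℕ) (b : ℕ),
    (∀ k ∈ r, k < b) → ∃ P : Prog G, ∀ x s, r.map s.reg = C.lay x →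
      (∀ k, b ≤ k → s.reg k = []) → P.RunsTo s (T x) (s.set b (f x))

namespace Ev

variable {α : Type} {C : Ctx α}

theorem map_set_reg {G : Type} {r : List ℕ} {b : ℕ} (hr : ∀ k ∈ r, k < b) (s : Store G) {k : ℕ}
    (hk : b ≤ k) (l : List Bool) : r.map (s.set k l).reg = r.map s.reg := by
  refine List.map_congr_left fun j hj => ?_
  have := hr j hj
  exact s.set_reg_of_ne l (by omega)

theorem of_eq {f g : α → List Bool} (hf : Ev C f) (h : ∀ x, f x = g x) : Ev C g :=
  funext h ▸ hf

/-- The contents of the `k`-th register of the context. -/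
theorem var {f : α → List Bool} (k : ℕ) (h : ∀ x, (C.lay x)[k]? = some (f x)) : Ev C f := by
  have hμ : C.Poly C.μ := ⟨1, fun x => by simp⟩
  have hlen : ∀ x, (f x).length ≤ C.μ x := fun x =>
    C.length_le x _ (List.mem_of_getElem? (h x))
  refine ⟨hμ.mono hlen, fun x => 9 * C.μ x + 2, ((Ctx.Poly.const 9).mul hμ).add (.const 2), ?_⟩
  intro G r b hr
  refine ⟨copy (r.getD k 0) b (b + 1), fun x s hs hb => ?_⟩
  have hx := h x
  rw [← hs, List.getElem?_map] at hx
  obtain ⟨j, hj, hjx⟩ := Option.map_eq_some_iff.1 hx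
  have hjb := hr j (List.mem_of_getElem? hj)
  rw [List.getD_eq_getElem?_getD, hj, Option.getD_some, ← hjx]
  refine (runsTo_copy (by omega) (by omega) (by omega) s (hb _ (by omega)) (hb _ le_rfl)).mono ?_
  have := hlen x
  simp only [hjx]; omega

theorem nil : Ev C fun _ => [] := by
  refine ⟨.const 0, fun _ => 1, .const 1, fun G r b _ => ⟨.skip, fun x s _ hb => ?_⟩⟩
  rw [s.set_eq_self (hb b le_rfl)]
  exact runsTo_skip s

theorem cons {f : α → List Bool} (a : Bool) (hf : Ev C f) : Ev C fun x => a :: f x := by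
  obtain ⟨hl, T, hT, hP⟩ := hf
  refine ⟨(hl.add (.const 1)).mono fun x => by simp, fun x => T x + 1, hT.add (.const 1), ?_⟩
  intro G r b hr
  obtain ⟨P, hP⟩ := hP G r b hr
  refine ⟨.seq P (.push b a), fun x s hs hb => ?_⟩
  have h2 := runsTo_push (G := G) b a (s.set b (f x))
  rw [Store.set_reg_self, Store.set_set] at h2
  exact (hP x s hs hb).seq h2

theorem const (l : List Bool) : Ev C fun _ => l := by
  induction l with
  | nil => exact nil
  | cons a l ih => exact ih.cons a

theorem append {f g : α → List Bool} (hf : Ev C f) (hg : Ev C g) : Ev C fun x => f x ++ g x := by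
  obtain ⟨hl, T, hT, hP⟩ := hf
  obtain ⟨hl', T', hT', hP'⟩ := hg
  refine ⟨(hl.add hl').mono fun x => by simp,
    fun x => T' x + (T x + (8 * (f x).length + 2)),
    hT'.add (hT.add (((Ctx.Poly.const 8).mul hl).add (.const 2))), fun G r b hr => ?_⟩
  obtain ⟨P', hP'⟩ := hP' G r b hr
  obtain ⟨P, hP⟩ := hP G r (b + 1) fun k hk => (hr k hk).trans (Nat.lt_succ_self b)
  -- the second part is computed first, so that the first one can be put in front of it
  refine ⟨.seq P' (.seq P (shift (b + 1) b (b + 2))), fun x s hs hb => ?_⟩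
  have h1 := hP' x s hs hb
  have h2 := hP x (s.set b (g x)) (by rw [map_set_reg hr s le_rfl, hs]) fun k hk => by
    rw [Store.set_reg_of_ne _ _ (by omega), hb k (by omega)]
  have h3 := runsTo_shift (k := b + 1) (j := b) (l := b + 2) (by omega) (by omega) (by omega)
    ((s.set b (g x)).set (b + 1) (f x)) (by simp [hb])
  refine (h1.seq (h2.seq h3)).of_eq (Store.ext (funext fun i => ?_) rfl) ?_
  · have e := hb (b + 1) (by omega)
    simp only [Store.set_reg]
    split_ifs <;> first | omega | (subst_vars; simp [e])
  · simp

end Ev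

end BuchiQuotient

namespace BuchiQuotient

open Prog

namespace Ev

variable {α : Type} {C : Ctx α}

/-- The second list serves only as a counter, by its length. -/
theorem drop {f g : α → List Bool} (hf : Ev C f) (hg : Ev C g) :
    Ev C fun x => (f x).drop (g x).length := by
  obtain ⟨hl, T, hT, hP⟩ := hf
  obtain ⟨hl', T', hT', hP'⟩ := hg
  refine ⟨hl.mono fun x => by simp, fun x => T x + (T' x + (g x).length * 3 + 1),
    hT.add ((hT'.add (hl'.mul (.const 3))).add (.const 1)), fun G r b hr => ?_⟩
  obtain ⟨P, hP⟩ := hP G r b hr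
  obtain ⟨P', hP'⟩ := hP' G r (b + 1) fun k hk => (hr k hk).trans (Nat.lt_succ_self b)
  refine ⟨.seq P (.seq P' (loop (b + 1) (.seq (pop (b + 1)) (pop b)))), fun x s hs hb => ?_⟩
  have h1 := hP x s hs hb
  have h2 := hP' x (s.set b (f x)) (by rw [map_set_reg hr s le_rfl, hs]) fun k hk => by
    rw [Store.set_reg_of_ne _ _ (by omega), hb k (by omega)]
  -- the store when `i` rounds remain
  let st := fun i => (s.set b ((f x).drop ((g x).length - i))).set (b + 1)
    ((g x).drop ((g x).length - i))
  have h3 := runsTo_loop (G := G) (P := .seq (pop (b + 1)) (pop b)) (k := b + 1) (T := 2) st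
    (g x).length (fun i hi => by simp [st]; omega) fun i hi => by
      refine ((runsTo_pop _ _).seq (runsTo_pop _ _)).of_eq ?_ le_rfl
      have e : (g x).length - i = (g x).length - (i + 1) + 1 := by omega
      refine Store.ext (funext fun j => ?_) rfl
      simp only [Store.set_reg, st, e, ← List.drop_drop, List.drop_one]
      split_ifs <;> first | rfl | omega
  have e : st (g x).length = (s.set b (f x)).set (b + 1) (g x) := by simp [st]
  rw [e] at h3
  refine (h1.seq (h2.seq h3)).of_eq (Store.ext (funext fun i => ?_) rfl) (by simp only; omega)
  have e := hb (b + 1) (by omega)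
  simp only [Store.set_reg, st]
  split_ifs with hi
  · subst hi; omega
  · subst hi; simp [e]
  · simp
  · rfl

theorem cond {c f g : α → List Bool} (hc : Ev C c) (hf : Ev C f) (hg : Ev C g) :
    Ev C fun x => if (c x).head? = some true then f x else g x := by
  obtain ⟨hl₀, T₀, hT₀, hP₀⟩ := hc
  obtain ⟨hl, T, hT, hP⟩ := hf
  obtain ⟨hl', T', hT', hP'⟩ := hg
  refine ⟨(hl.add hl').mono fun x => by
      beta_reduce; split_ifs <;> simp,
    fun x => T₀ x + (T x + T' x + 2 * (c x).length + 2),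
    hT₀.add (((hT.add hT').add ((Ctx.Poly.const 2).mul hl₀)).add (.const 2)),
    fun G r b hr => ?_⟩
  have hr' : ∀ k ∈ r, k < b + 1 := fun k hk => (hr k hk).trans (Nat.lt_succ_self b)
  obtain ⟨P₀, hP₀⟩ := hP₀ G r b hr
  obtain ⟨P, hP⟩ := hP G r b hr
  obtain ⟨P', hP'⟩ := hP' G r b hr
  refine ⟨.seq P₀ (ite b (.seq (clear b) P) (.seq (clear b) P')), fun x s hs hb => ?_⟩
  have h0 := hP₀ x s hs hb
  have h1 := runsTo_clear b (s.set b (c x))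
  rw [Store.set_set, Store.set_reg_self, s.set_eq_self (hb b le_rfl)] at h1
  refine (h0.seq (RunsTo.ite (T := T x + T' x + 2 * (c x).length + 1) (fun hk => ?_)
    fun hk => ?_)).mono (by simp only; omega)
  · rw [Store.set_reg_self] at hk
    simp only [if_pos hk]
    exact (h1.seq (hP x s hs hb)).mono (by omega)
  · rw [Store.set_reg_self] at hk
    simp only [if_neg hk]
    exact (h1.seq (hP' x s hs hb)).mono (by omega)

/-- Concatenation over a range; the loop counts down, so that the pieces are put in front of each
other. -/
theorem flatMap {n : α → ℕ} {f : α → ℕ → List Bool} (hn : Ev C fun x => un (n x))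
    (hf : Ev C.num fun y => f y.1 y.2) :
    Ev C fun x => (List.range (n x)).flatMap (f x) := by
  obtain ⟨hl, T, hT, hP⟩ := hn
  obtain ⟨hl', T', hT', hP'⟩ := hf
  simp only [length_un] at hl
  obtain ⟨L, hL, hLle⟩ := hl'.num hl
  obtain ⟨U, hU, hUle⟩ := hT'.num hl
  refine ⟨(hl.mul hL).mono fun x => ?_, fun x => T x + (n x * (U x + 8 * L x + 3 + 1) + 1),
    hT.add ((hl.mul (((hU.add ((Ctx.Poly.const 8).mul hL)).add (.const 3)).add
      (.const 1))).add (.const 1)),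
    fun G r b hr => ?_⟩
  · rw [List.length_flatMap]
    refine (List.sum_le_card_nsmul _ (L x) fun k hk => ?_).trans (by simp)
    obtain ⟨i, hi, rfl⟩ := List.mem_map.1 hk
    exact hLle x i (List.mem_range.1 hi).le
  obtain ⟨P, hP⟩ := hP G r (b + 1) fun k hk => (hr k hk).trans (Nat.lt_succ_self b)
  obtain ⟨P', hP'⟩ := hP' G ((b + 1) :: r) (b + 2) fun k hk => by
    rcases List.mem_cons.1 hk with rfl | hk
    · omega
    · have := hr k hk; omega
  refine ⟨.seq P (loop (b + 1) (.seq (pop (b + 1)) (.seq P' (shift (b + 2) b (b + 3))))),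
    fun x s hs hb => ?_⟩
  have h1 := hP x s hs fun k hk => hb k (by omega)
  -- the store when `i` rounds remain
  let st := fun i => (s.set b (((List.range (n x)).drop i).flatMap (f x))).set (b + 1) (un i)
  have h2 := runsTo_loop (G := G) (P := .seq (pop (b + 1)) (.seq P' (shift (b + 2) b (b + 3))))
    (k := b + 1) (T := U x + 8 * L x + 3) st (n x) (fun i hi => by simp [st]) fun i hi => by
      let s' := (s.set b (((List.range (n x)).drop (i + 1)).flatMap (f x))).set (b + 1) (un i)
      have e1 : (st (i + 1)).set (b + 1) ((st (i + 1)).reg (b + 1)).tail = s' := by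
        simp [st, s', un]
      have h1 := runsTo_pop (b + 1) (st (i + 1))
      rw [e1] at h1
      have h2 := hP' (x, i) s' (by
        simp only [List.map_cons, Ctx.num, s', Store.set_reg_self]
        rw [map_set_reg hr _ (by omega), map_set_reg hr _ le_rfl, hs]) fun k hk => by
          simp only [s']
          rw [Store.set_reg_of_ne _ _ (by omega), Store.set_reg_of_ne _ _ (by omega),
            hb k (by omega)]
      have h3 := runsTo_shift (k := b + 2) (j := b) (l := b + 3) (by omega) (by omega) (by omega)
        (s'.set (b + 2) (f x i)) (by simp [s', hb])
      refine (h1.seq (h2.seq h3)).of_eq (Store.ext (funext fun j => ?_) rfl) ?_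
      · have e := hb (b + 2) (by omega)
        have e' : (List.range (n x)).drop i = i :: (List.range (n x)).drop (i + 1) := by
          rw [List.drop_eq_getElem_cons (by simpa using hi)]; simp
        simp only [Store.set_reg, st, s', e', List.flatMap_cons]
        split_ifs <;> first | omega | (subst_vars; simp [e])
      · have := hUle x i hi.le
        have := hLle x i hi.le
        simp only [Store.set_reg_self]
        simp only at *
        omega
  have e : st (n x) = s.set (b + 1) (un (n x)) := by
    have : (List.range (n x)).drop (n x) = [] := by simp
    simp only [st, this, List.flatMap_nil]
    rw [s.set_eq_self (hb b le_rfl)]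
  rw [e] at h2
  refine (h1.seq h2).of_eq ?_ (by simp only; omega)
  have e := hb (b + 1) (by omega)
  simp only [st, List.drop_zero]
  exact Store.set_eq_self _ (by simp [e, un])

/-- Iteration, as often as the list `c x` is long, provided that the size of the
iterates stays polynomial. -/
theorem iterate {c f : α → List Bool} {g : α → List Bool → List Bool} (hc : Ev C c)
    (hf : Ev C f) (hg : Ev C.arr fun y => g y.1 y.2) {L : α → ℕ} (hL : C.Poly L)
    (hLle : ∀ x, ∀ t ≤ (c x).length, ((g x)^[t] (f x)).length ≤ L x) :
    Ev C fun x => (g x)^[(c x).length] (f x) := by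
  obtain ⟨hl₀, T₀, hT₀, hP₀⟩ := hc
  obtain ⟨hl, T, hT, hP⟩ := hf
  obtain ⟨-, T', hT', hP'⟩ := hg
  obtain ⟨U, hU, hUle⟩ := hT'.arr hL
  refine ⟨hL.mono fun x => hLle x _ le_rfl,
    fun x => T x + (T₀ x + ((c x).length * (U x + 10 * L x + 4 + 1) + 1)),
    hT.add (hT₀.add ((hl₀.mul (((hU.add ((Ctx.Poly.const 10).mul hL)).add (.const 4)).add
      (.const 1))).add (.const 1))), fun G r b hr => ?_⟩
  obtain ⟨P, hP⟩ := hP G r b hr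
  obtain ⟨P₀, hP₀⟩ := hP₀ G r (b + 1) fun k hk => (hr k hk).trans (Nat.lt_succ_self b)
  obtain ⟨P', hP'⟩ := hP' G (b :: r) (b + 2) fun k hk => by
    rcases List.mem_cons.1 hk with rfl | hk
    · omega
    · have := hr k hk; omega
  refine ⟨.seq P (.seq P₀ (loop (b + 1) (.seq (pop (b + 1)) (.seq P' (.seq (clear b)
    (shift (b + 2) b (b + 3))))))), fun x s hs hb => ?_⟩
  have h1 := hP x s hs hb
  have h1' := hP₀ x (s.set b (f x)) (by rw [map_set_reg hr s le_rfl, hs]) fun k hk => by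
    rw [Store.set_reg_of_ne _ _ (by omega), hb k (by omega)]
  -- the store when `i` rounds remain
  let st := fun i => (s.set b ((g x)^[(c x).length - i] (f x))).set (b + 1)
    ((c x).drop ((c x).length - i))
  have h2 := runsTo_loop (G := G)
    (P := .seq (pop (b + 1)) (.seq P' (.seq (clear b) (shift (b + 2) b (b + 3)))))
    (k := b + 1) (T := U x + 10 * L x + 4) st (c x).length
    (fun i hi => by simp [st]; omega) fun i hi => by
      have e : (c x).length - i = (c x).length - (i + 1) + 1 := by omega
      let A := (g x)^[(c x).length - (i + 1)] (f x)
      have hA : A.length ≤ L x := hLle x _ (by omega)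
      have hA' : (g x A).length ≤ L x := by
        have := hLle x ((c x).length - i) (by omega)
        rwa [e, Function.iterate_succ_apply'] at this
      let s' := (s.set b A).set (b + 1) ((c x).drop ((c x).length - i))
      have e1 : (st (i + 1)).set (b + 1) ((st (i + 1)).reg (b + 1)).tail = s' := by
        simp only [st, s', Store.set_reg_self, Store.set_set, e, ← List.drop_drop, List.drop_one, A]
      have h1 := runsTo_pop (b + 1) (st (i + 1))
      rw [e1] at h1
      have h2 := hP' (x, A) s' (by
        simp only [List.map_cons, Ctx.arr, s']
        rw [map_set_reg hr _ (by omega), map_set_reg hr _ le_rfl, hs,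
          Store.set_reg_of_ne _ _ (by omega), Store.set_reg_self]) fun k hk => by
          simp only [s']
          rw [Store.set_reg_of_ne _ _ (by omega), Store.set_reg_of_ne _ _ (by omega),
            hb k (by omega)]
      have h3 := runsTo_clear b (s'.set (b + 2) (g x A))
      have h4 := runsTo_shift (k := b + 2) (j := b) (l := b + 3) (by omega) (by omega) (by omega)
        ((s'.set (b + 2) (g x A)).set b []) (by simp [s', hb])
      refine (h1.seq (h2.seq (h3.seq h4))).of_eq (Store.ext (funext fun j => ?_) rfl) ?_
      · have e2 := hb (b + 2) (by omega)
        have e3 : (g x)^[(c x).length - i] (f x) = g x A := by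
          rw [e, Function.iterate_succ_apply']
        simp only [Store.set_reg, st, s', e3]
        split_ifs <;> first | omega | (subst_vars; simp [e2])
      · have := hUle x A hA
        have e4 : (s'.set (b + 2) (g x A)).reg b = A := by simp [s']
        have e5 : ((s'.set (b + 2) (g x A)).set b []).reg (b + 2) = g x A := by simp
        rw [e4, e5]
        simp only at *
        omega
  have e : st (c x).length = (s.set b (f x)).set (b + 1) (c x) := by simp [st]
  rw [e] at h2
  refine (h1.seq (h1'.seq h2)).of_eq ?_ (by simp only; omega)
  have e := hb (b + 1) (by omega)
  simp only [st, Nat.sub_zero]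
  exact Store.set_eq_self _ (by simp [e])

end Ev

end BuchiQuotient

namespace BuchiQuotient

open Prog

/-! ### Evaluable functions are computable in exponential time -/

/-- Emit the symbols coded by the pairs of bits on register `k`, starting with the last one. -/
def emitPairs {G : Type} (dec : Bool × Bool → G) (k : ℕ) : Prog G :=
  loop k (ite k
    (seq (pop k) (ite k (seq (pop k) (emit (dec (true, true))))
      (seq (pop k) (emit (dec (false, true))))))
    (seq (pop k) (ite k (seq (pop k) (emit (dec (true, false))))
      (seq (pop k) (emit (dec (false, false)))))))

theorem runsTo_emitPairs {G : Type} (dec : Bool × Bool → G) (k : ℕ) (l : List (Bool × Bool))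
    (s : Store G) (hs : s.reg k = (l.flatMap fun p => [p.1, p.2]).reverse) :
    (emitPairs dec k).RunsTo s (7 * l.length + 1)
      { (s.set k []) with out := l.map dec ++ s.out } := by
  induction l using List.reverseRecOn generalizing s with
  | nil =>
    refine ⟨1, by omega, ?_⟩
    rw [s.set_eq_self (by simpa using hs)]
    exact .loop_nil (by simpa using hs)
  | append_singleton l p ih =>
    obtain ⟨a, b⟩ := p
    let v := (l.flatMap fun p : Bool × Bool => [p.1, p.2]).reverse
    have hs : s.reg k = b :: a :: v := by simpa [v] using hs
    have h1 := runsTo_pop k s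
    have h2 := runsTo_pop k (s.set k (a :: v))
    rw [hs, List.tail_cons] at h1
    rw [Store.set_reg_self, List.tail_cons, Store.set_set] at h2
    have h3 := runsTo_emit (dec (a, b)) (s.set k v)
    have h := ih { (s.set k v) with out := dec (a, b) :: s.out } (by simp [v])
    have hb : (ite k
      (seq (pop k) (ite k (seq (pop k) (emit (dec (true, true))))
        (seq (pop k) (emit (dec (false, true))))))
      (seq (pop k) (ite k (seq (pop k) (emit (dec (true, false))))
        (seq (pop k) (emit (dec (false, false))))))).RunsTo s 6
        { (s.set k v) with out := dec (a, b) :: s.out } := by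
      refine (RunsTo.ite (T := 1 + (1 + 1 + 1)) (fun e => h1.seq (.ite (fun e' => ?_) fun e' => ?_))
        fun e => h1.seq (.ite (fun e' => ?_) fun e' => ?_)).mono (by omega)
      all_goals
        simp [hs] at e e'
        subst e e'
        exact h2.seq h3
    refine (RunsTo.loop_cons (by simp [hs]) hb h).of_eq ?_ (by simp; omega)
    refine Store.ext (funext fun i => ?_) (by simp)
    simp only [Store.set, Function.update_idem]

/-- If a function is evaluable with respect to a measure of the form `2 ^ (n + 2) ^ k`, where `n` is
the length of the input, and its values are written as sequences of pairs of bits, then it is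
computable in exponential time. -/
theorem computableInExpTime_of_ev {α β G : Type} [Fintype G] {ea : α → List Bool}
    {eb : β → List G} {f : α → β} (C : Ctx α) (hC : ∀ a, C.lay a = [ea a]) (k : ℕ)
    (hμ : ∀ a, C.μ a = 2 ^ ((ea a).length + 2) ^ k) (g : α → List (Bool × Bool))
    (hg : Ev C fun a => (g a).flatMap fun p => [p.1, p.2]) (dec : Bool × Bool → G)
    (h : ∀ a, eb (f a) = (g a).map dec) : ComputableInExpTime ea eb f := by
  obtain ⟨hl, T, hT, hP⟩ := hg
  obtain ⟨P, hP⟩ := hP G [0] 1 (by simp)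
  have hlen : ∀ a, ((g a).flatMap fun p => [p.1, p.2]).length = 2 * (g a).length := fun a => by
    simp [List.length_flatMap, mul_comm]
  simp only [hlen] at hl
  -- the time for the evaluation, for clearing the input, for reversing the value and for writing it
  have hea : C.Poly fun a => (ea a).length := ⟨1, fun a => by
    rw [pow_one]; exact C.length_le a _ (by simp [hC])⟩
  obtain ⟨d, hd⟩ := ((hT.add (((Ctx.Poly.const 2).mul hea).add (.const 1))).add
    (((Ctx.Poly.const 4).mul hl).add (.const 1))).add (((Ctx.Poly.const 7).mul hl).add (.const 1))
  have hrun : ∀ a, ∃ t ≤ 2 ^ (((ea a).length + 2) ^ k * d),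
      Run (.seq P (.seq (clear 0) (.seq (move 1 2) (emitPairs dec 2))))
        ⟨Function.update (fun _ => []) 0 (ea a), []⟩ t ⟨fun _ => [], eb (f a)⟩ := by
    intro a
    let s : Store G := ⟨Function.update (fun _ => []) 0 (ea a), []⟩
    let F := (g a).flatMap fun p => [p.1, p.2]
    have h1 := hP a s (by simp [s, hC]) fun j hj => by
      simp only [s]
      rw [Function.update_of_ne (by omega)]
    have h2 := runsTo_clear 0 (s.set 1 F)
    have h3 := runsTo_move (k := 1) (j := 2) (by omega) ((s.set 1 F).set 0 [])
    have h4 := runsTo_emitPairs dec 2 (g a)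
      ((((s.set 1 F).set 0 []).set 2 ((((s.set 1 F).set 0 []).reg 1).reverse ++
        ((s.set 1 F).set 0 []).reg 2)).set 1 []) (by simp [s, F])
    have hfin := h1.seq (h2.seq (h3.seq h4))
    refine hfin.of_eq (Store.ext (funext fun i => ?_) ?_) ?_
    · simp only [Store.set_reg, s]
      split_ifs <;> simp_all
    · simp [h, s]
    · rw [pow_mul, ← hμ]
      refine le_trans ?_ (hd a)
      have e1 : (s.set 1 F).reg 0 = ea a := by simp [s]
      have e2 : ((s.set 1 F).set 0 []).reg 1 = F := by simp
      rw [e1, e2, hlen]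
      beta_reduce
      omega
  obtain ⟨c, hc⟩ := Run.computableInTime (f := f) (eb := eb) _ (fun n => 2 ^ ((n + 2) ^ k * d)) hrun
  refine ⟨c, (Polynomial.X + 2) ^ k * Polynomial.C d + 1, fun n => ?_⟩
  rw [hc]
  simp only [Polynomial.eval_add, Polynomial.eval_mul, Polynomial.eval_pow, Polynomial.eval_X,
    Polynomial.eval_C, Polynomial.eval_one, Polynomial.eval_ofNat, pow_succ 2]
  have := Nat.one_le_two_pow (n := (n + 2) ^ k * d)
  omega

/-! ### Numbers and predicates -/

/-- Evaluability of a numerical function, with values in unary. -/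
def EvN {α : Type} (C : Ctx α) (f : α → ℕ) : Prop := Ev C fun x => un (f x)

open scoped Classical in
/-- Evaluability of a predicate. -/
def EvP {α : Type} (C : Ctx α) (p : α → Prop) : Prop := Ev C fun x => if p x then [true] else []

variable {α : Type} {C : Ctx α}

theorem Ctx.Poly.weaken {β : Type} {D : Ctx (α × β)} (hD : ∀ y, C.μ y.1 ≤ D.μ y) {g : α → ℕ}
    (hg : C.Poly g) : D.Poly fun y => g y.1 :=
  let ⟨d, hd⟩ := hg
  ⟨d, fun y => (hd y.1).trans (Nat.pow_le_pow_left (hD y) d)⟩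

/-- A variable in front of the others can be ignored. -/
protected theorem Ev.weaken {β : Type} {D : Ctx (α × β)} (hD : ∀ y, C.μ y.1 ≤ D.μ y)
    (hD' : ∀ y, (D.lay y).tail = C.lay y.1) {f : α → List Bool} (hf : Ev C f) :
    Ev D fun y => f y.1 := by
  obtain ⟨hl, T, hT, hP⟩ := hf
  refine ⟨hl.weaken hD, fun y => T y.1, hT.weaken hD, fun G r b hr => ?_⟩
  obtain ⟨P, hP⟩ := hP G r.tail b fun k hk => hr k (List.mem_of_mem_tail hk)
  exact ⟨P, fun y s hs hb => hP y.1 s (by rw [← hD', ← hs, List.map_tail]) hb⟩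

protected theorem Ev.num {f : α → List Bool} (hf : Ev C f) : Ev C.num fun y => f y.1 :=
  hf.weaken (fun _ => Nat.le_add_right _ _) fun _ => rfl

protected theorem Ev.arr {f : α → List Bool} (hf : Ev C f) : Ev C.arr fun y => f y.1 :=
  hf.weaken (fun _ => Nat.le_add_right _ _) fun _ => rfl

protected theorem Ev.arr_snd : Ev C.arr fun y => y.2 := Ev.var 0 fun _ => rfl

protected theorem EvN.num {f : α → ℕ} (hf : EvN C f) : EvN C.num fun y => f y.1 := Ev.num hf

protected theorem EvN.arr {f : α → ℕ} (hf : EvN C f) : EvN C.arr fun y => f y.1 := Ev.arr hf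

protected theorem EvN.num_snd : EvN C.num fun y => y.2 := Ev.var 0 fun _ => rfl

protected theorem EvP.of_iff {p q : α → Prop} (hp : EvP C p) (h : ∀ x, p x ↔ q x) : EvP C q := by
  obtain rfl : p = q := funext fun x => propext (h x)
  exact hp

protected theorem EvN.of_eq {f g : α → ℕ} (hf : EvN C f) (h : ∀ x, f x = g x) : EvN C g :=
  funext h ▸ hf

protected theorem EvN.poly {f : α → ℕ} (hf : EvN C f) : C.Poly f := hf.1.mono fun x => by simp

protected theorem Ev.ite {p : α → Prop} {_ : ∀ x, Decidable (p x)} {f g : α → List Bool}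
    (hp : EvP C p) (hf : Ev C f) (hg : Ev C g) : Ev C fun x => if p x then f x else g x := by
  refine (Ev.cond hp hf hg).of_eq fun x => ?_
  by_cases h : p x <;> simp [h]

protected theorem EvN.ite {p : α → Prop} {_ : ∀ x, Decidable (p x)} {f g : α → ℕ}
    (hp : EvP C p) (hf : EvN C f) (hg : EvN C g) : EvN C fun x => if p x then f x else g x :=
  (Ev.ite hp hf hg).of_eq fun _ => (apply_ite un _ _ _).symm

namespace EvP

theorem const (p : Prop) : EvP C fun _ => p := Ev.const _

/-- A predicate is evaluable if it tells whether an evaluable list starts with `true`. -/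
theorem of_head {f : α → List Bool} {p : α → Prop} (hf : Ev C f)
    (h : ∀ x, p x ↔ (f x).head? = some true) : EvP C p :=
  (Ev.cond hf (Ev.const [true]) Ev.nil).of_eq fun x => by simp only [h]

/-- The connectives are all obtained from case distinction. -/
theorem ite {p q r : α → Prop} (hp : EvP C p) (hq : EvP C q) (hr : EvP C r) :
    EvP C fun x => (p x ∧ q x) ∨ (¬ p x ∧ r x) :=
  (Ev.cond hp hq hr).of_eq fun x => by
    by_cases h : p x <;> by_cases h' : q x <;> by_cases h'' : r x <;> simp [h, h', h'']

theorem not {p : α → Prop} (hp : EvP C p) : EvP C fun x => ¬ p x :=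
  (hp.ite (const False) (const True)).of_iff fun x => by tauto

theorem and {p q : α → Prop} (hp : EvP C p) (hq : EvP C q) : EvP C fun x => p x ∧ q x :=
  (hp.ite hq (const False)).of_iff fun x => by tauto

theorem or {p q : α → Prop} (hp : EvP C p) (hq : EvP C q) : EvP C fun x => p x ∨ q x :=
  (hp.ite (const True) hq).of_iff fun x => by tauto

theorem imp {p q : α → Prop} (hp : EvP C p) (hq : EvP C q) : EvP C fun x => p x → q x :=
  (hp.ite hq (const True)).of_iff fun x => by tauto

theorem iff {p q : α → Prop} (hp : EvP C p) (hq : EvP C q) : EvP C fun x => (p x ↔ q x) :=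
  (hp.ite hq hq.not).of_iff fun x => by tauto

/-- Reading an entry of a list. -/
theorem getD {A : α → List Bool} {i : α → ℕ} (hA : Ev C A) (hi : EvN C i) :
    EvP C fun x => (A x).getD (i x) false = true :=
  of_head (hA.drop hi) fun x => by
    rw [length_un, List.head?_drop, List.getD_eq_getElem?_getD]
    cases (A x)[i x]? <;> simp

theorem lt {f g : α → ℕ} (hf : EvN C f) (hg : EvN C g) : EvP C fun x => f x < g x :=
  of_head (Ev.drop hg hf) fun x => by
    rw [length_un, List.head?_drop]
    simp [un, List.getElem?_replicate]

theorem le {f g : α → ℕ} (hf : EvN C f) (hg : EvN C g) : EvP C fun x => f x ≤ g x :=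
  (lt hg hf).not.of_iff fun _ => not_lt

theorem eq {f g : α → ℕ} (hf : EvN C f) (hg : EvN C g) : EvP C fun x => f x = g x :=
  ((le hf hg).and (le hg hf)).of_iff fun _ => le_antisymm_iff.symm

theorem exists_lt {n : α → ℕ} {p : α → ℕ → Prop} (hn : EvN C n)
    (hp : EvP C.num fun y => p y.1 y.2) : EvP C fun x => ∃ i, i < n x ∧ p x i := by
  classical
  refine of_head (Ev.flatMap (f := fun x i => if p x i then [true] else []) hn
    (Ev.of_eq hp fun y => by simp)) fun x => ?_
  have h : ∀ l : List ℕ, (∃ i, i ∈ l ∧ p x i) ↔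
      (l.flatMap fun i => if p x i then [true] else []).head? = some true := by
    intro l
    induction l with
    | nil => simp
    | cons a l ih => by_cases h : p x a <;> simp [h, ih]
  simpa using h (List.range (n x))

theorem forall_lt {n : α → ℕ} {p : α → ℕ → Prop} (hn : EvN C n)
    (hp : EvP C.num fun y => p y.1 y.2) : EvP C fun x => ∀ i, i < n x → p x i :=
  (exists_lt (p := fun x i => ¬ p x i) hn hp.not).not.of_iff fun x => by push Not; rfl

end EvP

open scoped Classical in
/-- Tabulation of a predicate. -/
protected theorem Ev.tab {n : α → ℕ} {p : α → ℕ → Prop} (hn : EvN C n)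
    (hp : EvP C.num fun y => p y.1 y.2) :
    Ev C fun x => (List.range (n x)).map fun i => decide (p x i) := by
  refine (Ev.flatMap (f := fun x i => if p x i then [true] else [false]) hn
    (Ev.ite hp (Ev.const _) (Ev.const _))).of_eq fun x => ?_
  rw [List.map_eq_flatMap]
  congr 1
  funext i
  by_cases h : p x i <;> simp [h]

namespace EvN

theorem const (k : ℕ) : EvN C fun _ => k := Ev.const _

theorem add {f g : α → ℕ} (hf : EvN C f) (hg : EvN C g) : EvN C fun x => f x + g x :=
  (Ev.append hf hg).of_eq fun x => by simp [un]

theorem sum {n : α → ℕ} {f : α → ℕ → ℕ} (hn : EvN C n) (hf : EvN C.num fun y => f y.1 y.2) :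
    EvN C fun x => ∑ i ∈ Finset.range (n x), f x i := by
  refine (Ev.flatMap (f := fun x i => un (f x i)) hn hf).of_eq fun x => ?_
  beta_reduce
  induction n x with
  | zero => rfl
  | succ k ih =>
    rw [List.range_succ, List.flatMap_append, ih, Finset.sum_range_succ]
    simp [un]

theorem mul {f g : α → ℕ} (hf : EvN C f) (hg : EvN C g) : EvN C fun x => f x * g x :=
  (sum (f := fun x _ => g x) hf hg.num).of_eq fun x => by simp

/-- The number is counted out by a loop that adds one entry to an initially empty list in each
round. -/
theorem length {f : α → List Bool} (hf : Ev C f) : EvN C fun x => (f x).length := by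
  have h : ∀ t, (fun l : List Bool => true :: l)^[t] [] = un t := by
    intro t
    induction t with
    | zero => rfl
    | succ t ih => rw [Function.iterate_succ_apply', ih]; rfl
  refine (Ev.iterate (g := fun _ l => true :: l) hf Ev.nil (Ev.cons true Ev.arr_snd) hf.1
    fun x t ht => ?_).of_eq fun x => h _
  rw [h, length_un]
  exact ht

/-- A power of two, provided that it does not exceed the measure of the context. -/
theorem two_pow {e : α → ℕ} (he : EvN C e) (h : C.Poly fun x => 2 ^ e x) :
    EvN C fun x => 2 ^ e x := by
  have h2 : ∀ t, (fun l : List Bool => l ++ l)^[t] [true] = un (2 ^ t) := by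
    intro t
    induction t with
    | zero => rfl
    | succ t ih => rw [Function.iterate_succ_apply', ih]; simp [un, pow_succ, mul_two]
  refine (Ev.iterate (g := fun _ l => l ++ l) he (Ev.const [true])
    (Ev.append Ev.arr_snd Ev.arr_snd) h fun x t ht => ?_).of_eq fun x => ?_
  · rw [h2, length_un]
    exact Nat.pow_le_pow_right (by omega) (by simpa using ht)
  · rw [h2, length_un]

end EvN

/-! ### Iteration of predicates and least fixed points -/

/-- The predicate on numbers obtained from `init` by `t` applications of `body`, everything being
restricted to the numbers below `n`. -/
def iterPred (n : ℕ) (init : ℕ → Prop) (body : (ℕ → Prop) → ℕ → Prop) (t : ℕ) : ℕ → Prop :=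
  (fun S i => i < n ∧ body S i)^[t] fun i => i < n ∧ init i

theorem iterPred_succ (n : ℕ) (init : ℕ → Prop) (body : (ℕ → Prop) → ℕ → Prop) (t i : ℕ) :
    iterPred n init body (t + 1) i ↔ i < n ∧ body (iterPred n init body t) i := by
  rw [iterPred, Function.iterate_succ_apply', ← iterPred]

/-- Predicates on the numbers below `n` are held in a register as their tables; the tables of the
iterates all have length `n`. -/
protected theorem EvP.iterPred {n t i : α → ℕ} {init : α → ℕ → Prop}
    {body : α → (ℕ → Prop) → ℕ → Prop} (hn : EvN C n) (ht : EvN C t) (hi : EvN C i)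
    (hinit : EvP C.num fun y => init y.1 y.2)
    (hbody : EvP C.arr.num fun y => body y.1.1 (fun j => y.1.2.getD j false = true) y.2) :
    EvP C fun x => iterPred (n x) (init x) (body x) (t x) (i x) := by
  classical
  let A₀ := fun x => (List.range (n x)).map fun i => decide (init x i)
  let g := fun x (A : List Bool) => (List.range (n x)).map fun i =>
    decide (body x (fun j => A.getD j false = true) i)
  have hA₀ : Ev C A₀ := Ev.tab hn hinit
  have hg : Ev C.arr fun y => g y.1 y.2 :=
    Ev.tab (p := fun (y : α × List Bool) i => body y.1 (fun j => y.2.getD j false = true) i)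
      hn.arr hbody
  have hlen : ∀ x t, ((g x)^[t] (A₀ x)).length = n x := by
    intro x t
    cases t with
    | zero => simp [A₀]
    | succ t => rw [Function.iterate_succ_apply']; simp [g]
  have hit := Ev.iterate ht hA₀ hg hn.poly fun x t _ => (hlen x t).le
  simp only [length_un] at hit
  refine (EvP.getD hit hi).of_iff fun x => ?_
  have htab : ∀ (p : ℕ → Prop) (j : ℕ),
      ((List.range (n x)).map fun i => decide (p i)).getD j false = true ↔ j < n x ∧ p j := by
    intro p j
    rw [List.getD_eq_getElem?_getD, List.getElem?_map]
    by_cases h : j < n x <;> simp [h]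
  suffices h : ∀ t j, ((g x)^[t] (A₀ x)).getD j false = true ↔
      BuchiQuotient.iterPred (n x) (init x) (body x) t j from h _ _
  intro t
  induction t with
  | zero => exact htab _
  | succ t ih =>
    intro j
    rw [Function.iterate_succ_apply', iterPred_succ, htab, funext fun j => propext (ih j)]

/-- The binary digits of a number. The numbers whose digit at position `0` is set are the odd ones,
and those whose digit at position `t + 1` is set are the `i` such that the digit of `i / 2` at
position `t` is; so this is an instance of iteration of a predicate. -/
protected theorem EvP.testBit {f j : α → ℕ} (hf : EvN C f) (hj : EvN C j) :
    EvP C fun x => (f x).testBit (j x) = true := by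
  have hhalf : ∀ i, i / 2 < i + 1 := fun i => by omega
  have h0 : EvP C.num fun y => ∃ k, k < y.2 ∧ y.2 = 2 * k + 1 :=
    .exists_lt .num_snd (.eq EvN.num_snd.num (.add (.mul (.const 2) .num_snd) (.const 1)))
  have h1 : EvP C.arr.num fun y => ∃ k, k < y.2 + 1 ∧ (y.2 = 2 * k ∨ y.2 = 2 * k + 1) ∧
      y.1.2.getD k false = true :=
    .exists_lt (.add .num_snd (.const 1)) (.and
      (.or (.eq EvN.num_snd.num (.mul (.const 2) .num_snd))
        (.eq EvN.num_snd.num (.add (.mul (.const 2) .num_snd) (.const 1))))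
      (.getD Ev.arr_snd.num.num .num_snd))
  refine (EvP.iterPred (init := fun _ i => ∃ k, k < i ∧ i = 2 * k + 1)
    (body := fun _ S i => ∃ k, k < i + 1 ∧ (i = 2 * k ∨ i = 2 * k + 1) ∧ S k)
    (.add hf (.const 1)) hj hf h0 h1).of_iff fun x => ?_
  suffices h : ∀ t i, i ≤ f x → (BuchiQuotient.iterPred (f x + 1)
      (fun i => ∃ k, k < i ∧ i = 2 * k + 1)
      (fun S i => ∃ k, k < i + 1 ∧ (i = 2 * k ∨ i = 2 * k + 1) ∧ S k) t i ↔
        i.testBit t = true) from h _ _ le_rfl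
  intro t
  induction t with
  | zero =>
    intro i hi
    rw [Nat.testBit_zero, decide_eq_true_iff]
    constructor
    · rintro ⟨-, k, -, h⟩; omega
    · intro h; exact ⟨by omega, i / 2, by omega, by omega⟩
  | succ t ih =>
    intro i hi
    rw [iterPred_succ, Nat.testBit_succ, ← ih (i / 2) (by omega)]
    constructor
    · rintro ⟨-, k, -, h, hk⟩
      rwa [show i / 2 = k by omega]
    · intro h
      exact ⟨by omega, i / 2, by omega, by omega, h⟩

/-- The least predicate on the numbers below `n` that is closed under `op`. -/
def Lfp (op : (ℕ → Prop) → ℕ → Prop) (n i : ℕ) : Prop :=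
  ∀ S : ℕ → Prop, (∀ j < n, op S j → S j) → S i

theorem Lfp.closed {op : (ℕ → Prop) → ℕ → Prop}
    (hop : ∀ S S' : ℕ → Prop, (∀ j, S j → S' j) → ∀ j, op S j → op S' j) {n i : ℕ} (hi : i < n)
    (h : op (Lfp op n) i) : Lfp op n i :=
  fun S hS => hS i hi (hop _ _ (fun _ hj => hj S hS) i h)

/-- The least fixed point of a monotone operator on sets of numbers below `n` is reached within `n`
rounds, since every round but the last adds an element. -/
theorem iterPred_iff_lfp {op : (ℕ → Prop) → ℕ → Prop}
    (hop : ∀ S S' : ℕ → Prop, (∀ j, S j → S' j) → ∀ j, op S j → op S' j) (n i : ℕ) :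
    iterPred n (fun _ => False) op n i ↔ Lfp op n i := by
  classical
  let U := iterPred n (fun _ => False) op
  have hU : ∀ t i, U (t + 1) i ↔ i < n ∧ op (U t) i := fun t i => iterPred_succ _ _ _ t i
  have hmono : ∀ t i, U t i → U (t + 1) i := by
    intro t
    induction t with
    | zero => rintro i ⟨-, h⟩; exact h.elim
    | succ t ih =>
      intro i h
      rw [hU] at h ⊢
      exact ⟨h.1, hop _ _ ih i h.2⟩
  have hlt : ∀ t i, U t i → i < n := by
    intro t i h
    cases t with
    | zero => exact h.1
    | succ t => exact ((hU t i).1 h).1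
  have hstab : ∀ j, U (n + 1) j → U n j := by
    by_contra hne
    have hall : ∀ t ≤ n, ¬ ∀ j, U (t + 1) j → U t j := by
      intro t ht h
      have hk : ∀ k j, U (t + k + 1) j → U (t + k) j := by
        intro k
        induction k with
        | zero => exact h
        | succ k ih =>
          intro j hj
          rw [hU] at hj
          rw [← add_assoc, hU]
          exact ⟨hj.1, hop _ _ ih j hj.2⟩
      refine hne fun j => ?_
      have := hk (n - t) j
      rwa [show t + (n - t) = n by omega] at this
    have hcard : ∀ t ≤ n + 1, t ≤ ((Finset.range n).filter (U t)).card := by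
      intro t
      induction t with
      | zero => simp
      | succ t ih =>
        intro ht
        refine lt_of_le_of_lt (ih (by omega)) (Finset.card_lt_card ?_)
        rw [Finset.ssubset_iff_of_subset fun j hj => by
          rw [Finset.mem_filter] at hj ⊢
          exact ⟨hj.1, hmono t j hj.2⟩]
        have := hall t (by omega)
        push Not at this
        obtain ⟨j, hj, hj'⟩ := this
        exact ⟨j, by simp [hj, hlt _ _ hj], by simp [hj']⟩
    have := hcard (n + 1) le_rfl
    have h2 := Finset.card_filter_le (Finset.range n) (U (n + 1))
    rw [Finset.card_range] at h2
    omega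
  constructor
  · intro h S hS
    have : ∀ t j, U t j → S j := by
      intro t
      induction t with
      | zero => rintro j ⟨-, hj⟩; exact hj.elim
      | succ t ih =>
        intro j hj
        rw [hU] at hj
        exact hS j hj.1 (hop _ _ ih j hj.2)
    exact this n i h
  · intro h
    exact h _ fun j hj hop' => hstab j ((hU n j).2 ⟨hj, hop'⟩)

/-- Least fixed points of evaluable monotone operators are evaluable; the argument set of the
operator is given by its table. -/
protected theorem EvP.lfp {n i : α → ℕ} {op : α → (ℕ → Prop) → ℕ → Prop}
    (hop : ∀ x, ∀ S S' : ℕ → Prop, (∀ j, S j → S' j) → ∀ j, op x S j → op x S' j)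
    (hn : EvN C n) (hi : EvN C i)
    (hbody : EvP C.arr.num fun y => op y.1.1 (fun j => y.1.2.getD j false = true) y.2) :
    EvP C fun x => Lfp (op x) (n x) (i x) :=
  (EvP.iterPred hn hn hi (.const False) hbody).of_iff fun x => iterPred_iff_lfp (hop x) _ _

end BuchiQuotient

namespace BuchiQuotient

universe u v

namespace NBA

variable {Q : Type u} {S : Type v}

/-! ### The size of the arena -/

theorem clsProfile_cls (A : NBA Q S) (w : List S) : A.clsProfile (A.cls w) = A.profile w := rfl

theorem cls_surjective (A : NBA Q S) (c : A.TransMonoid) : ∃ w, A.cls w = c := by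
  induction c using Con.induction_on with
  | H w => exact ⟨w.toList, rfl⟩

theorem cls_eq_iff (A : NBA Q S) (u w : List S) :
    A.cls u = A.cls w ↔ A.profile u = A.profile w :=
  Con.eq A.wordCon

theorem cls_append (A : NBA Q S) (u w : List S) : A.cls (u ++ w) = A.cls u * A.cls w := rfl

theorem clsProfile_injective (A : NBA Q S) : Function.Injective A.clsProfile := by
  intro c d h
  obtain ⟨u, rfl⟩ := A.cls_surjective c
  obtain ⟨w, rfl⟩ := A.cls_surjective d
  exact (A.cls_eq_iff u w).2 h

instance [Finite Q] (A : NBA Q S) : Finite A.TransMonoid :=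
  Finite.of_injective _ A.clsProfile_injective

theorem card_transMonoid_le [Fintype Q] (A : NBA Q S) :
    Nat.card A.TransMonoid ≤ 3 ^ (Fintype.card Q) ^ 2 := by
  classical
  refine (Nat.card_le_card_of_injective _ A.clsProfile_injective).trans_eq ?_
  simp [← pow_mul, sq]

/-- The configurations as a sum of products. -/
def posEquiv (A : NBA Q S) : A.Pos ≃ (Q × Q × A.TransMonoid) ⊕
    (Q × Q × A.TransMonoid × A.TransMonoid × A.TransMonoid) where
  toFun
    | .refuter q q' b => Sum.inl (q, q', b)
    | .prover q q' b c₁ c₂ => Sum.inr (q, q', b, c₁, c₂)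
  invFun
    | Sum.inl (q, q', b) => .refuter q q' b
    | Sum.inr (q, q', b, c₁, c₂) => .prover q q' b c₁ c₂
  left_inv x := by cases x <;> rfl
  right_inv x := by rcases x with ⟨_, _, _⟩ | ⟨_, _, _, _, _⟩ <;> rfl

instance [Finite Q] (A : NBA Q S) : Finite A.Pos := Finite.of_equiv _ A.posEquiv.symm

theorem card_pos [Fintype Q] (A : NBA Q S) :
    Nat.card A.Pos =
      (Fintype.card Q) ^ 2 * (Nat.card A.TransMonoid + Nat.card A.TransMonoid ^ 3) := by
  rw [Nat.card_congr A.posEquiv, Nat.card_sum]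
  simp only [Nat.card_prod, Nat.card_eq_fintype_card]
  ring

/-- With `n = |Q|`, the bound `n² (3 ^ n² + 3 ^ (3 n²))` is at most `2 ^ n² * 2 * 2 ^ (5 n²)`, since
`27 ≤ 32`. -/
theorem card_pos_le_two_pow [Fintype Q] (A : NBA Q S) (hQ : 2 ≤ Fintype.card Q) :
    Nat.card A.Pos ≤ 2 ^ (8 * (Fintype.card Q) ^ 2) := by
  set n := Fintype.card Q
  have hc : Nat.card A.TransMonoid ≤ 3 ^ n ^ 2 := A.card_transMonoid_le
  have hn : 4 ≤ n ^ 2 := by nlinarith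
  have hn2 : n ^ 2 ≤ 2 ^ n ^ 2 := Nat.lt_two_pow_self.le
  have h27 : (3 ^ n ^ 2) ^ 3 ≤ (2 ^ n ^ 2) ^ 5 := by
    rw [← pow_mul, ← pow_mul, mul_comm _ 3, mul_comm _ 5, pow_mul, pow_mul]
    exact Nat.pow_le_pow_left (by norm_num) _
  have h3 : 3 ^ n ^ 2 ≤ (3 ^ n ^ 2) ^ 3 := Nat.le_self_pow (by norm_num) _
  have h2 : 2 ≤ 2 ^ n ^ 2 := by
    calc 2 = 2 ^ 1 := rfl
      _ ≤ 2 ^ n ^ 2 := Nat.pow_le_pow_right (by norm_num) (by omega)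
  rw [card_pos]
  calc n ^ 2 * (Nat.card A.TransMonoid + Nat.card A.TransMonoid ^ 3)
      ≤ 2 ^ n ^ 2 * ((2 ^ n ^ 2) ^ 5 + (2 ^ n ^ 2) ^ 5) := by
        refine Nat.mul_le_mul hn2 (add_le_add (hc.trans (h3.trans h27)) ?_)
        exact (Nat.pow_le_pow_left hc 3).trans h27
    _ = 2 ^ n ^ 2 * (2 * (2 ^ n ^ 2) ^ 5) := by ring
    _ ≤ 2 ^ n ^ 2 * (2 ^ n ^ 2 * (2 ^ n ^ 2) ^ 5) := by gcongr
    _ = 2 ^ (7 * n ^ 2) := by ring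
    _ ≤ 2 ^ (8 * n ^ 2) := Nat.pow_le_pow_right (by norm_num) (by omega)

/-- Since `log |Q| ≥ log 2 > 1 / 2`, an exponent `8 |Q|²` is at most `16 |Q|² log |Q|`. -/
theorem card_pos_le [Fintype Q] (A : NBA Q S) (hQ : 2 ≤ Fintype.card Q) :
    (Nat.card A.Pos : ℝ) ≤
      (2 : ℝ) ^ (16 * (Fintype.card Q : ℝ) ^ 2 * Real.log (Fintype.card Q)) := by
  have h1 : (Nat.card A.Pos : ℝ) ≤ (2 : ℝ) ^ (8 * (Fintype.card Q) ^ 2) := by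
    exact_mod_cast A.card_pos_le_two_pow hQ
  have hlog : (1 / 2 : ℝ) ≤ Real.log (Fintype.card Q) := by
    have h2 : Real.log 2 ≤ Real.log (Fintype.card Q) :=
      Real.log_le_log (by norm_num) (by exact_mod_cast hQ)
    have := Real.log_two_gt_d9
    linarith
  refine h1.trans ?_
  rw [← Real.rpow_natCast]
  refine Real.rpow_le_rpow_of_exponent_le (by norm_num) ?_
  push_cast
  have : (0 : ℝ) ≤ 16 * (Fintype.card Q : ℝ) ^ 2 := by positivity
  nlinarith

/-! ### Plays -/

theorem Play.pos_eq_none_of_le {A : NBA Q S} {q₀ : Q} (π : A.Play q₀) {n m : ℕ} (h : n ≤ m)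
    (hn : π.pos n = none) : π.pos m = none := by
  induction m, h using Nat.le_induction with
  | base => exact hn
  | succ m _ ih => exact π.ended m ih

theorem Play.pos_succ_eq_none {A : NBA Q S} {q₀ : Q} (π : A.Play q₀) {n : ℕ} {x : A.Pos}
    (hn : π.pos n = some x) (hx : A.Stuck x) : π.pos (n + 1) = none := by
  rcases h : π.pos (n + 1) with _ | y
  · rfl
  · exact (hx y (π.move n x y hn h)).elim

/-- A play has at most one last configuration. -/
theorem Play.stuck_unique {A : NBA Q S} {q₀ : Q} (π : A.Play q₀) {n m : ℕ} {x y : A.Pos}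
    (hn : π.pos n = some x) (hx : A.Stuck x) (hm : π.pos m = some y) (hy : A.Stuck y) : x = y := by
  have h1 := π.pos_succ_eq_none hn hx
  have h2 := π.pos_succ_eq_none hm hy
  rcases lt_trichotomy n m with h | rfl | h
  · rw [π.pos_eq_none_of_le h h1] at hm; cases hm
  · rw [hn] at hm; exact Option.some.inj hm
  · rw [π.pos_eq_none_of_le h h2] at hn; cases hn

/-- A play that Refuter wins is finite, and the last configuration is one of Prover. Conversely a
play that reaches a configuration in which Prover is stuck ends there. -/
theorem Play.refuterWins_iff {A : NBA Q S} {q₀ : Q} (π : A.Play q₀) :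
    π.RefuterWins ↔ ∃ n x, π.pos n = some x ∧ x.IsProver ∧ A.Stuck x := by
  constructor
  · intro h
    have h : ¬ ((∃ n x, π.pos n = some x ∧ ¬ x.IsProver ∧ A.Stuck x) ∨
      ∀ n, π.pos n ≠ none) := h
    push Not at h
    obtain ⟨h1, h2⟩ := h
    classical
    have hpos : Nat.find h2 ≠ 0 := by
      intro e
      have := Nat.find_spec h2
      rw [e, π.pos_zero] at this
      cases this
    obtain ⟨n, hn⟩ := Nat.exists_eq_succ_of_ne_zero hpos
    have hlast : π.pos n ≠ none := Nat.find_min h2 (by omega)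
    obtain ⟨x, hx⟩ := Option.ne_none_iff_exists'.1 hlast
    have hstuck : A.Stuck x := π.stuck n x hx (by
      have := Nat.find_spec h2
      rwa [hn] at this)
    by_cases hp : x.IsProver
    · exact ⟨n, x, hx, hp, hstuck⟩
    · exact (h1 n x hx hp hstuck).elim
  · rintro ⟨n, x, hx, hp, hstuck⟩ (⟨m, y, hy, hy', hy''⟩ | h)
    · obtain rfl := π.stuck_unique hx hstuck hy hy''
      exact hy' hp
    · exact h _ (π.pos_succ_eq_none hx hstuck)

/-! ### Determinacy -/

/-- The configurations `(p, p', b)` from which Refuter can force Prover to get stuck. -/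
inductive Lose (A : NBA Q S) : Q → Q → A.TransMonoid → Prop
  | intro {p p' q : Q} {b c₁ c₂ : A.TransMonoid} (h₁ : A.ClsReach p c₁ q)
      (h₂ : A.ClsAccReach q c₂ q) (hc : IsIdempotentElem c₂)
      (h : ∀ q', A.ClsReach p' (b * c₁ * c₂) q' → A.ClsAccReach q' c₂ q' → Lose A q q' c₂) :
      Lose A p p' b

/-- The configurations that are good for Prover: Refuter cannot force a win from there. -/
def Good (A : NBA Q S) : A.Pos → Prop
  | .refuter q q' b => ¬ A.Lose q q' b
  | .prover q p' b c₁ c₂ => ∃ q', A.ClsReach p' (b * c₁ * c₂) q' ∧ A.ClsAccReach q' c₂ q' ∧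
      ¬ A.Lose q q' c₂

theorem Good.of_move {A : NBA Q S} {x y : A.Pos} (hx : A.Good x) (hp : ¬ x.IsProver)
    (h : A.Move x y) : A.Good y := by
  cases h with
  | prover h₁ h₂ => exact (hp trivial).elim
  | refuter h₁ h₂ hc =>
    by_contra hy
    refine hx (.intro h₁ h₂ hc fun q' h3 h4 => ?_)
    by_contra hl
    exact hy ⟨q', h3, h4, hl⟩

theorem Good.exists_move {A : NBA Q S} {x : A.Pos} (hx : A.Good x) (hp : x.IsProver) :
    ∃ y, A.Move x y ∧ A.Good y := by
  cases x with
  | refuter => exact hp.elim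
  | prover =>
    obtain ⟨q', h1, h2, h3⟩ := hx
    exact ⟨_, .prover h1 h2, h3⟩

/-- Prover wins by always moving to a good configuration. -/
theorem proverHasWinningStrategy_of_not_lose {A : NBA Q S} {q₀ : Q}
    (h : ¬ A.Lose A.start q₀ (A.cls [])) : A.ProverHasWinningStrategy q₀ := by
  classical
  let next : A.Pos → A.Pos := fun x =>
    if h : ∃ y, A.Move x y ∧ A.Good y then h.choose
    else if h' : ∃ y, A.Move x y then h'.choose else x
  refine ⟨⟨fun _ => next, fun _ x _ hs => ?_⟩, fun π hπ => ?_⟩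
  · have h' : ∃ y, A.Move x y := by
      unfold Stuck at hs
      push Not at hs
      exact hs
    by_cases h : ∃ y, A.Move x y ∧ A.Good y
    · simp only [next, dif_pos h]
      exact h.choose_spec.1
    · simp only [next, dif_neg h, dif_pos h']
      exact h'.choose_spec
  · have hgood : ∀ n x, π.pos n = some x → A.Good x := by
      intro n
      induction n with
      | zero =>
        intro x hx
        rw [π.pos_zero] at hx
        cases hx
        exact h
      | succ n ih =>
        intro y hy
        rcases hx : π.pos n with _ | x
        · rw [π.ended n hx] at hy; cases hy
        · by_cases hp : x.IsProver
          · have e : ∃ y, A.Move x y ∧ A.Good y := (ih x hx).exists_move hp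
            have := hπ n x y hx hp hy
            simp only [next, dif_pos e] at this
            rw [this]
            exact e.choose_spec.2
          · exact (ih x hx).of_move hp (π.move n x y hx hy)
    by_contra hwin
    obtain ⟨n, x, hx, hp, hs⟩ := π.refuterWins_iff.1 hwin
    obtain ⟨y, hy, -⟩ := (hgood n x hx).exists_move hp
    exact hs y hy

/-- A finite sequence of configurations that starts in the initial one, follows the rules, and in
which Prover follows the strategy `σ`. -/
structure IsPrefix {A : NBA Q S} (σ : A.ProverStrategy) (q₀ : Q) (l : List A.Pos) : Prop where
  head : l[0]? = some (A.initPos q₀)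
  move : ∀ n x y, l[n]? = some x → l[n + 1]? = some y → A.Move x y
  follows : ∀ n x y, l[n]? = some x → x.IsProver → l[n + 1]? = some y → y = σ.next (l.take n) x

theorem IsPrefix.append {A : NBA Q S} {σ : A.ProverStrategy} {q₀ : Q} {l : List A.Pos} {x y : A.Pos}
    (h : IsPrefix σ q₀ (l ++ [x])) (hm : A.Move x y) (hf : x.IsProver → y = σ.next l x) :
    IsPrefix σ q₀ (l ++ [x] ++ [y]) := by
  have key : ∀ n z z', (l ++ [x] ++ [y])[n]? = some z → (l ++ [x] ++ [y])[n + 1]? = some z' →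
      ((l ++ [x])[n]? = some z ∧ (l ++ [x])[n + 1]? = some z' ∧ n < l.length) ∨
      (n = l.length ∧ z = x ∧ z' = y) := by
    intro n z z' hz hz'
    rcases lt_trichotomy n l.length with hn | rfl | hn
    · left
      rw [List.getElem?_append_left (by simp; omega)] at hz hz'
      exact ⟨hz, hz', hn⟩
    · right
      simp at hz hz'
      exact ⟨rfl, hz.symm, hz'.symm⟩
    · rw [List.getElem?_eq_none (by simp; omega)] at hz'
      cases hz'
  refine ⟨?_, fun n z z' hz hz' => ?_, fun n z z' hz hp hz' => ?_⟩
  · rw [List.getElem?_append_left (by simp)]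
    exact h.head
  · rcases key n z z' hz hz' with ⟨h1, h2, -⟩ | ⟨-, rfl, rfl⟩
    · exact h.move n z z' h1 h2
    · exact hm
  · rcases key n z z' hz hz' with ⟨h1, h2, hn⟩ | ⟨rfl, rfl, rfl⟩
    · have := h.follows n z z' h1 hp h2
      rwa [List.take_append_of_le_length (by simp; omega)]
    · rw [hf hp]
      simp

/-- From a lost configuration Refuter can extend any initial part of a play, against every strategy
of Prover, so that Prover gets stuck. -/
theorem Lose.exists_isPrefix {A : NBA Q S} {σ : A.ProverStrategy} {q₀ p p' : Q} {b : A.TransMonoid}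
    (hl : A.Lose p p' b) (l : List A.Pos) (h : IsPrefix σ q₀ (l ++ [.refuter p p' b])) :
    ∃ l' x, IsPrefix σ q₀ (l' ++ [x]) ∧ x.IsProver ∧ A.Stuck x := by
  induction hl generalizing l with
  | @intro p p' q b c₁ c₂ h₁ h₂ hc hlose ih =>
    have h' := h.append (.refuter h₁ h₂ hc) fun hp => hp.elim
    by_cases hs : A.Stuck (.prover q p' b c₁ c₂)
    · exact ⟨_, _, h', trivial, hs⟩
    · have hm := σ.legal (l ++ [.refuter p p' b]) (.prover q p' b c₁ c₂) trivial hs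
      have h'' := h'.append hm fun _ => rfl
      generalize σ.next (l ++ [.refuter p p' b]) (.prover q p' b c₁ c₂) = y at hm h''
      cases hm with
      | prover h3 h4 => exact ih _ h3 h4 _ h''

/-- An initial part that ends in a stuck configuration is a complete play. -/
theorem IsPrefix.exists_play {A : NBA Q S} {σ : A.ProverStrategy} {q₀ : Q} {l : List A.Pos}
    {x : A.Pos} (h : IsPrefix σ q₀ (l ++ [x])) (hx : A.Stuck x) :
    ∃ π : A.Play q₀, π.Follows σ ∧ π.pos l.length = some x := by
  refine ⟨⟨fun n => (l ++ [x])[n]?, h.head, h.move, fun n y hy hn => ?_, fun n hn => ?_⟩,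
    fun n y z hy hp hz => ?_, by simp⟩
  · obtain ⟨hlt, -⟩ := List.getElem?_eq_some_iff.1 hy
    have hle := List.getElem?_eq_none_iff.1 hn
    obtain rfl : n = l.length := by simp at hlt hle; omega
    simp at hy
    exact hy ▸ hx
  · exact List.getElem?_eq_none (le_trans (List.getElem?_eq_none_iff.1 hn) (Nat.le_succ n))
  · have hn : n ≤ (l ++ [x]).length := (List.getElem?_eq_some_iff.1 hy).1.le
    have e : ∀ (L : List A.Pos) n, n ≤ L.length →
        (List.range n).filterMap (fun i => L[i]?) = L.take n := by
      intro L n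
      induction n with
      | zero => simp
      | succ n ih =>
        intro hn
        rw [List.range_succ, List.filterMap_append, ih (by omega), List.take_add_one]
        simp [List.getElem?_eq_getElem (show n < L.length from hn)]
    rw [e _ _ hn]
    exact h.follows n y z hy hp hz

/-- The game is determined: Prover wins unless Refuter can force a win from the initial
configuration. -/
theorem proverHasWinningStrategy_iff {A : NBA Q S} {q₀ : Q} :
    A.ProverHasWinningStrategy q₀ ↔ ¬ A.Lose A.start q₀ (A.cls []) := by
  refine ⟨?_, proverHasWinningStrategy_of_not_lose⟩
  rintro ⟨σ, hσ⟩ hl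
  obtain ⟨l, x, hpre, hp, hs⟩ := hl.exists_isPrefix (σ := σ) (q₀ := q₀) []
    ⟨rfl, fun n x y _ h => by simp at h, fun n x y _ _ h => by simp at h⟩
  obtain ⟨π, hπ, hx⟩ := hpre.exists_play hs
  exact π.refuterWins_iff.2 ⟨_, x, hx, hp, hs⟩ (hσ π hπ)

end NBA

end BuchiQuotient

namespace BuchiQuotient

/-! ### Numerical codes of transition profiles -/

/-- The codes of pairs of relations on `n` states are the numbers below `cap n`. -/
def cap (n : ℕ) : ℕ := 2 ^ (2 * (n * n))

/-- The first relation of the pair coded by `T`: the even binary digits. -/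
def RelBit (n T p q : ℕ) : Prop := T.testBit (2 * (p * n + q)) = true

/-- The second relation of the pair coded by `T`: the odd binary digits. -/
def AccBit (n T p q : ℕ) : Prop := T.testBit (2 * (p * n + q) + 1) = true

/-- Every pair of relations has a code. -/
theorem exists_code {n : ℕ} (P P' : Fin n → Fin n → Prop) :
    ∃ T < cap n, ∀ p q : Fin n, (RelBit n T p q ↔ P p q) ∧ (AccBit n T p q ↔ P' p q) := by
  classical
  let f : Fin (2 * (n * n)) → Bool := fun i =>
    if h : ∃ p q : Fin n, (i : ℕ) / 2 = p * n + q ∧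
      (((i : ℕ) % 2 = 0 ∧ P p q) ∨ ((i : ℕ) % 2 = 1 ∧ P' p q)) then true else false
  have hinj : ∀ p q p' q' : Fin n, (p : ℕ) * n + q = p' * n + q' → p = p' ∧ q = q' := by
    intro p q p' q' h
    have h1 := congrArg (· / n) h
    have h2 := congrArg (· % n) h
    have hn : 0 < n := p.pos
    simp only [Nat.mul_comm _ n, Nat.mul_add_div hn, Nat.div_eq_of_lt q.isLt,
      Nat.div_eq_of_lt q'.isLt, Nat.mul_add_mod, Nat.mod_eq_of_lt q.isLt,
      Nat.mod_eq_of_lt q'.isLt] at h1 h2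
    exact ⟨Fin.ext (by omega), Fin.ext h2⟩
  refine ⟨Nat.ofBits f, Nat.ofBits_lt_two_pow f, fun p q => ?_⟩
  have hlt : (p : ℕ) * n + q < n * n := by
    have h1 : ((p : ℕ) + 1) * n ≤ n * n := Nat.mul_le_mul_right _ p.isLt
    have h2 := q.isLt
    rw [Nat.succ_mul] at h1
    omega
  constructor
  · rw [RelBit, Nat.testBit_ofBits_lt _ _ (by omega)]
    simp only [f, dite_eq_ite, Bool.if_false_right, Bool.and_true, decide_eq_true_iff]
    constructor
    · rintro ⟨p', q', h, ⟨-, h'⟩ | ⟨h', -⟩⟩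
      · obtain ⟨rfl, rfl⟩ := hinj p q p' q' (by omega)
        exact h'
      · omega
    · exact fun h => ⟨p, q, by omega, Or.inl ⟨by omega, h⟩⟩
  · rw [AccBit, Nat.testBit_ofBits_lt _ _ (by omega)]
    simp only [f, dite_eq_ite, Bool.if_false_right, Bool.and_true, decide_eq_true_iff]
    constructor
    · rintro ⟨p', q', h, ⟨h', -⟩ | ⟨-, h'⟩⟩
      · omega
      · obtain ⟨rfl, rfl⟩ := hinj p q p' q' (by omega)
        exact h'
    · exact fun h => ⟨p, q, by omega, Or.inr ⟨by omega, h⟩⟩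

theorem code_unique {n T T' : ℕ} (hT : T < cap n) (hT' : T' < cap n)
    (h : ∀ p q : Fin n, (RelBit n T p q ↔ RelBit n T' p q) ∧ (AccBit n T p q ↔ AccBit n T' p q)) :
    T = T' := by
  refine Nat.eq_of_testBit_eq fun i => ?_
  by_cases hi : i < 2 * (n * n)
  · have hn : 0 < n := Nat.pos_of_ne_zero fun h0 => by simp [h0] at hi
    have hp : i / 2 / n < n := Nat.div_lt_of_lt_mul (by omega)
    have hq : i / 2 % n < n := Nat.mod_lt _ hn
    have e : i / 2 / n * n + i / 2 % n = i / 2 := Nat.div_add_mod' _ _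
    obtain ⟨h1, h2⟩ := h ⟨_, hp⟩ ⟨_, hq⟩
    simp only [RelBit, AccBit, e] at h1 h2
    rw [Bool.eq_iff_iff]
    rcases Nat.mod_two_eq_zero_or_one i with h0 | h0
    · rwa [show 2 * (i / 2) = i by omega] at h1
    · rwa [show 2 * (i / 2) + 1 = i by omega] at h2
  · have hle : cap n ≤ 2 ^ i := Nat.pow_le_pow_right (by omega) (by omega)
    rw [Nat.testBit_lt_two_pow (hT.trans_le hle), Nat.testBit_lt_two_pow (hT'.trans_le hle)]

/-- `T` codes the identity relation and the empty relation, which belong to the empty word. -/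
def IsEps (n T : ℕ) : Prop :=
  ∀ p, p < n → ∀ q, q < n → (RelBit n T p q ↔ p = q) ∧ ¬ AccBit n T p q

/-- There is a path from `p` to `q` along the product of the classes coded by `T` and `T'`. -/
def RelProd (n T T' p q : ℕ) : Prop := ∃ r, r < n ∧ RelBit n T p r ∧ RelBit n T' r q

/-- There is an accepting path from `p` to `q` along the product of the classes coded by `T` and
`T'`. -/
def AccProd (n T T' p q : ℕ) : Prop :=
  ∃ r, r < n ∧ ((AccBit n T p r ∧ RelBit n T' r q) ∨ (RelBit n T p r ∧ AccBit n T' r q))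

/-- `T` codes an idempotent. -/
def IsIdem (n T : ℕ) : Prop :=
  ∀ p, p < n → ∀ q, q < n → (RelProd n T T p q ↔ RelBit n T p q) ∧
    (AccProd n T T p q ↔ AccBit n T p q)

/-- `T'` codes the class of a word, `T` that of its extension by the letter `a`; `D` and `F` are
the transition relation and the set of accepting states. -/
def IsStep (n : ℕ) (D : ℕ → ℕ → ℕ → Prop) (F : ℕ → Prop) (T' a T : ℕ) : Prop :=
  ∀ p, p < n → ∀ q, q < n → (RelBit n T p q ↔ ∃ r, r < n ∧ RelBit n T' p r ∧ D r a q) ∧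
    (AccBit n T p q ↔ ∃ r, r < n ∧ ((AccBit n T' p r ∧ D r a q) ∨
      (RelBit n T' p r ∧ D r a q ∧ F q)))

/-- The operator whose least fixed point consists of the codes of all classes of words. -/
def memOp (n m : ℕ) (D : ℕ → ℕ → ℕ → Prop) (F : ℕ → Prop) (M : ℕ → Prop) (T : ℕ) : Prop :=
  IsEps n T ∨ ∃ T', T' < cap n ∧ M T' ∧ ∃ a, a < m ∧ IsStep n D F T' a T

theorem memOp_mono (n m : ℕ) (D : ℕ → ℕ → ℕ → Prop) (F : ℕ → Prop) (S S' : ℕ → Prop)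
    (h : ∀ j, S j → S' j) (T : ℕ) (hT : memOp n m D F S T) : memOp n m D F S' T :=
  hT.imp_right fun ⟨T', h1, h2, h3⟩ => ⟨T', h1, h _ h2, h3⟩

/-- The number of the configuration `(p, p', b)`, where `T` codes `b`. -/
def posCode (n p p' T : ℕ) : ℕ := (p * n + p') * cap n + T

/-- The operator whose least fixed point consists of the configurations from which Refuter can force
a win; `M` is the set of codes of classes. -/
def loseOp (n : ℕ) (M : ℕ → Prop) (W : ℕ → Prop) (i : ℕ) : Prop :=
  ∃ p, p < n ∧ ∃ p', p' < n ∧ ∃ T, T < cap n ∧ i = posCode n p p' T ∧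
    ∃ T₁, T₁ < cap n ∧ M T₁ ∧ ∃ T₂, T₂ < cap n ∧ M T₂ ∧ ∃ q, q < n ∧
      RelBit n T₁ p q ∧ AccBit n T₂ q q ∧ IsIdem n T₂ ∧
      ∀ q', q' < n → (∃ r, r < n ∧ RelProd n T T₁ p' r ∧ RelBit n T₂ r q') →
        AccBit n T₂ q' q' → W (posCode n q q' T₂)

theorem loseOp_mono (n : ℕ) (M : ℕ → Prop) (S S' : ℕ → Prop)
    (h : ∀ j, S j → S' j) (i : ℕ) (hi : loseOp n M S i) : loseOp n M S' i := by
  obtain ⟨p, hp, p', hp', T, hT, e, T₁, h₁, h₁', T₂, h₂, h₂', q, hq, h3, h4, h5, h6⟩ := hi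
  exact ⟨p, hp, p', hp', T, hT, e, T₁, h₁, h₁', T₂, h₂, h₂', q, hq, h3, h4, h5,
    fun q' hq' hr ha => h _ (h6 q' hq' hr ha)⟩

theorem posCode_lt {n p p' T : ℕ} (hp : p < n) (hp' : p' < n) (hT : T < cap n) :
    posCode n p p' T < n * n * cap n := by
  have h1 : (p + 1) * n ≤ n * n := Nat.mul_le_mul_right _ hp
  have h2 : (p * n + p' + 1) * cap n ≤ n * n * cap n :=
    Nat.mul_le_mul_right _ (by rw [Nat.succ_mul] at h1; omega)
  rw [posCode]
  rw [Nat.succ_mul] at h2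
  omega

theorem posCode_inj {n p p' T q q' T' : ℕ} (hp' : p' < n) (hT : T < cap n) (hq' : q' < n)
    (hT' : T' < cap n) (h : posCode n p p' T = posCode n q q' T') : p = q ∧ p' = q' ∧ T = T' := by
  have aux : ∀ {a b c d k : ℕ}, b < k → d < k → a * k + b = c * k + d → a = c ∧ b = d := by
    intro a b c d k hb hd h
    have h1 := congrArg (· / k) h
    have h2 := congrArg (· % k) h
    have hk : 0 < k := by omega
    simp only [Nat.mul_comm _ k, Nat.mul_add_div hk, Nat.div_eq_of_lt hb,
      Nat.div_eq_of_lt hd, Nat.mul_add_mod, Nat.mod_eq_of_lt hb, Nat.mod_eq_of_lt hd] at h1 h2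
    exact ⟨by omega, h2⟩
  obtain ⟨h1, h2⟩ := aux hT hT' h
  obtain ⟨h3, h4⟩ := aux hp' hq' h1
  exact ⟨h3, h4, h2⟩

variable {n m : ℕ}

/-- `T` is the code of the class of the word `w`. -/
def Codes (A : NBA (Fin n) (Fin m)) (T : ℕ) (w : List (Fin m)) : Prop :=
  T < cap n ∧ ∀ p q : Fin n, (RelBit n T p q ↔ A.Reach p w q) ∧ (AccBit n T p q ↔ A.AccReach p w q)

namespace Codes

variable {A : NBA (Fin n) (Fin m)}

theorem exists_of_word (A : NBA (Fin n) (Fin m)) (w : List (Fin m)) : ∃ T, Codes A T w :=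
  let ⟨T, h, h'⟩ := exists_code (fun p q => A.Reach p w q) (fun p q => A.AccReach p w q)
  ⟨T, h, h'⟩

theorem cls_eq_iff {T T' : ℕ} {w w' : List (Fin m)} (h : Codes A T w) (h' : Codes A T' w') :
    A.cls w = A.cls w' ↔ T = T' := by
  rw [A.cls_eq_iff, A.profile_eq_iff]
  constructor
  · refine fun e => code_unique h.1 h'.1 fun p q => ?_
    rw [(h.2 p q).1, (h.2 p q).2, (h'.2 p q).1, (h'.2 p q).2]
    exact e p q
  · rintro rfl p q
    exact ⟨(h.2 p q).1.symm.trans (h'.2 p q).1, (h.2 p q).2.symm.trans (h'.2 p q).2⟩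

theorem nil_iff {T : ℕ} : Codes A T [] ↔ T < cap n ∧ IsEps n T := by
  constructor
  · refine fun h => ⟨h.1, fun p hp q hq => ?_⟩
    obtain ⟨h1, h2⟩ := h.2 ⟨p, hp⟩ ⟨q, hq⟩
    exact ⟨h1.trans (by simp [NBA.Reach]), fun h3 => h2.1 h3⟩
  · refine fun ⟨hT, h⟩ => ⟨hT, fun p q => ?_⟩
    obtain ⟨h1, h2⟩ := h p p.isLt q q.isLt
    exact ⟨h1.trans (by simp [NBA.Reach, Fin.ext_iff]), fun h3 => (h2 h3).elim, fun h3 => h3.elim⟩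

theorem relProd_iff {T T' : ℕ} {w w' : List (Fin m)} (h : Codes A T w) (h' : Codes A T' w')
    (p q : Fin n) : RelProd n T T' p q ↔ A.Reach p (w ++ w') q := by
  rw [A.reach_append]
  constructor
  · rintro ⟨r, hr, h1, h2⟩
    exact ⟨⟨r, hr⟩, (h.2 p ⟨r, hr⟩).1.1 h1, (h'.2 ⟨r, hr⟩ q).1.1 h2⟩
  · rintro ⟨r, h1, h2⟩
    exact ⟨r, r.isLt, (h.2 p r).1.2 h1, (h'.2 r q).1.2 h2⟩

theorem accProd_iff {T T' : ℕ} {w w' : List (Fin m)} (h : Codes A T w) (h' : Codes A T' w')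
    (p q : Fin n) : AccProd n T T' p q ↔ A.AccReach p (w ++ w') q := by
  rw [A.accReach_append]
  constructor
  · rintro ⟨r, hr, h1⟩
    refine ⟨⟨r, hr⟩, ?_⟩
    rwa [← (h.2 p ⟨r, hr⟩).1, ← (h.2 p ⟨r, hr⟩).2, ← (h'.2 ⟨r, hr⟩ q).1, ← (h'.2 ⟨r, hr⟩ q).2]
  · rintro ⟨r, h1⟩
    refine ⟨r, r.isLt, ?_⟩
    rwa [(h.2 p r).1, (h.2 p r).2, (h'.2 r q).1, (h'.2 r q).2]

theorem isIdem_iff {T : ℕ} {w : List (Fin m)} (h : Codes A T w) :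
    IsIdem n T ↔ IsIdempotentElem (A.cls w) := by
  rw [IsIdempotentElem, ← A.cls_append, A.cls_eq_iff, A.profile_eq_iff]
  constructor
  · intro hi p q
    rw [← h.relProd_iff h, ← h.accProd_iff h, ← (h.2 p q).1, ← (h.2 p q).2]
    exact hi p p.isLt q q.isLt
  · intro hi p hp q hq
    have := hi ⟨p, hp⟩ ⟨q, hq⟩
    rw [← h.relProd_iff h, ← h.accProd_iff h, ← (h.2 _ _).1, ← (h.2 _ _).2] at this
    exact this

/-- The class of `w ++ [a]` is computed from that of `w`. -/
theorem snoc_iff {D : ℕ → ℕ → ℕ → Prop} {F : ℕ → Prop}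
    (hD : ∀ (r : Fin n) (a : Fin m) (q : Fin n), D r a q ↔ (r, a, q) ∈ A.δ)
    (hF : ∀ q : Fin n, F q ↔ q ∈ A.F) {T T' : ℕ} {w : List (Fin m)} {a : Fin m}
    (h : Codes A T' w) : Codes A T (w ++ [a]) ↔ T < cap n ∧ IsStep n D F T' a T := by
  have h1 : ∀ p q : Fin n, A.Reach p (w ++ [a]) q ↔
      ∃ r, r < n ∧ RelBit n T' p r ∧ D r a q := by
    intro p q
    rw [A.reach_append]
    simp only [NBA.Reach]
    constructor
    · rintro ⟨r, hr, q', hq', rfl⟩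
      exact ⟨r, r.isLt, (h.2 p r).1.2 hr, (hD _ _ _).2 hq'⟩
    · rintro ⟨r, hr, h1, h2⟩
      exact ⟨⟨r, hr⟩, (h.2 p ⟨r, hr⟩).1.1 h1, q, (hD ⟨r, hr⟩ a q).1 h2, rfl⟩
  have h2 : ∀ p q : Fin n, A.AccReach p (w ++ [a]) q ↔
      ∃ r, r < n ∧ ((AccBit n T' p r ∧ D r a q) ∨ (RelBit n T' p r ∧ D r a q ∧ F q)) := by
    intro p q
    rw [A.accReach_append]
    simp only [NBA.Reach, NBA.AccReach]
    constructor
    · rintro ⟨r, ⟨hr, q', hq', rfl⟩ | ⟨hr, q', hq', ⟨hf, rfl⟩ | hf⟩⟩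
      · exact ⟨r, r.isLt, Or.inl ⟨(h.2 p r).2.2 hr, (hD _ _ _).2 hq'⟩⟩
      · exact ⟨r, r.isLt, Or.inr ⟨(h.2 p r).1.2 hr, (hD _ _ _).2 hq', (hF _).2 hf⟩⟩
      · exact hf.elim
    · rintro ⟨r, hr, ⟨h1, h2⟩ | ⟨h1, h2, h3⟩⟩
      · exact ⟨⟨r, hr⟩, Or.inl ⟨(h.2 p ⟨r, hr⟩).2.1 h1, q, (hD ⟨r, hr⟩ a q).1 h2, rfl⟩⟩
      · exact ⟨⟨r, hr⟩, Or.inr ⟨(h.2 p ⟨r, hr⟩).1.1 h1, q, (hD ⟨r, hr⟩ a q).1 h2,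
          Or.inl ⟨(hF q).1 h3, rfl⟩⟩⟩
  refine and_congr_right fun _ => ?_
  simp only [h1, h2]
  exact ⟨fun hT p hp q hq => hT ⟨p, hp⟩ ⟨q, hq⟩, fun hT p q => hT p p.isLt q q.isLt⟩

end Codes

/-- The codes of classes form the closure of the code of the empty word under extension by
letters. -/
theorem lfp_memOp_iff {A : NBA (Fin n) (Fin m)} {D : ℕ → ℕ → ℕ → Prop} {F : ℕ → Prop}
    (hD : ∀ (r : Fin n) (a : Fin m) (q : Fin n), D r a q ↔ (r, a, q) ∈ A.δ)
    (hF : ∀ q : Fin n, F q ↔ q ∈ A.F) (T : ℕ) :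
    Lfp (memOp n m D F) (cap n) T ↔ ∃ w, Codes A T w := by
  constructor
  · intro h
    refine h (fun T => ∃ w, Codes A T w) fun T hT => ?_
    rintro (h0 | ⟨T', -, ⟨w, hw⟩, a, ha, hs⟩)
    · exact ⟨[], Codes.nil_iff.2 ⟨hT, h0⟩⟩
    · exact ⟨w ++ [⟨a, ha⟩], (hw.snoc_iff hD hF).2 ⟨hT, hs⟩⟩
  · rintro ⟨w, hw⟩
    induction w using List.reverseRecOn generalizing T with
    | nil => exact Lfp.closed (memOp_mono n m D F) hw.1 (Or.inl (Codes.nil_iff.1 hw).2)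
    | append_singleton w a ih =>
      obtain ⟨T', hT'⟩ := Codes.exists_of_word A w
      exact Lfp.closed (memOp_mono n m D F) hw.1 (Or.inr ⟨T', hT'.1, ih T' hT', a, a.isLt,
        ((hT'.snoc_iff hD hF).1 hw).2⟩)

/-- On codes, the configurations from which Refuter can force a win are a least fixed point. -/
theorem lfp_loseOp_iff {A : NBA (Fin n) (Fin m)} {M : ℕ → Prop}
    (hM : ∀ T, M T ↔ ∃ w, Codes A T w) {p p' : Fin n} {T : ℕ} {w : List (Fin m)}
    (hw : Codes A T w) :
    Lfp (loseOp n M) (n * n * cap n) (posCode n p p' T) ↔ A.Lose p p' (A.cls w) := by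
  have hprod : ∀ {T T₁ T₂ : ℕ} {w w₁ w₂ : List (Fin m)}, Codes A T w → Codes A T₁ w₁ →
      Codes A T₂ w₂ → ∀ p' q' : Fin n, (∃ r, r < n ∧ RelProd n T T₁ p' r ∧ RelBit n T₂ r q') ↔
        A.ClsReach p' (A.cls w * A.cls w₁ * A.cls w₂) q' := by
    intro T T₁ T₂ w w₁ w₂ h h₁ h₂ p' q'
    rw [← A.cls_append, ← A.cls_append, A.clsReach_cls, A.reach_append]
    constructor
    · rintro ⟨r, hr, h3, h4⟩
      exact ⟨⟨r, hr⟩, (h.relProd_iff h₁ p' ⟨r, hr⟩).1 h3, (h₂.2 ⟨r, hr⟩ q').1.1 h4⟩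
    · rintro ⟨r, h3, h4⟩
      exact ⟨r, r.isLt, (h.relProd_iff h₁ p' r).2 h3, (h₂.2 r q').1.2 h4⟩
  constructor
  · intro h
    refine h (fun i => ∀ (p p' : Fin n) (T : ℕ) (w : List (Fin m)), Codes A T w →
      i = posCode n p p' T → A.Lose p p' (A.cls w)) ?_ p p' T w hw rfl
    rintro i - ⟨p₁, hp, p₁', hp', T', hT, rfl, T₁, -, hM₁, T₂, -, hM₂, q, hq, h1, h2, h3, h4⟩
      p p' T w hw e
    obtain ⟨rfl, rfl, rfl⟩ := posCode_inj hp' hT p'.isLt hw.1 e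
    obtain ⟨w₁, hw₁⟩ := (hM T₁).1 hM₁
    obtain ⟨w₂, hw₂⟩ := (hM T₂).1 hM₂
    refine .intro (q := ⟨q, hq⟩) (c₁ := A.cls w₁) (c₂ := A.cls w₂) ?_ ?_ ?_ fun q' h5 h6 => ?_
    · exact (A.clsReach_cls _ _ _).2 ((hw₁.2 p ⟨q, hq⟩).1.1 h1)
    · exact (A.clsAccReach_cls _ _ _).2 ((hw₂.2 ⟨q, hq⟩ ⟨q, hq⟩).2.1 h2)
    · exact hw₂.isIdem_iff.1 h3
    · exact h4 q' q'.isLt ((hprod hw hw₁ hw₂ p' q').2 h5)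
        ((hw₂.2 q' q').2.2 ((A.clsAccReach_cls _ _ _).1 h6)) ⟨q, hq⟩ q' T₂ w₂ hw₂ rfl
  · intro h
    generalize hb : A.cls w = b at h
    induction h generalizing T w with
    | @intro p p' q b c₁ c₂ h₁ h₂ hc h ih =>
      subst hb
      obtain ⟨w₁, rfl⟩ := A.cls_surjective c₁
      obtain ⟨w₂, rfl⟩ := A.cls_surjective c₂
      obtain ⟨T₁, hT₁⟩ := Codes.exists_of_word A w₁
      obtain ⟨T₂, hT₂⟩ := Codes.exists_of_word A w₂
      refine Lfp.closed (loseOp_mono n M) (posCode_lt p.isLt p'.isLt hw.1)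
        ⟨p, p.isLt, p', p'.isLt, T, hw.1, rfl, T₁, hT₁.1, (hM _).2 ⟨_, hT₁⟩, T₂, hT₂.1,
          (hM _).2 ⟨_, hT₂⟩, q, q.isLt, ?_, ?_, hT₂.isIdem_iff.2 hc, fun q' hq' h3 h4 => ?_⟩
      · exact (hT₁.2 p q).1.2 ((A.clsReach_cls _ _ _).1 h₁)
      · exact (hT₂.2 q q).2.2 ((A.clsAccReach_cls _ _ _).1 h₂)
      · exact ih ⟨q', hq'⟩ ((hprod hw hT₁ hT₂ p' ⟨q', hq'⟩).1 h3)
          ((A.clsAccReach_cls _ _ _).2 ((hT₂.2 ⟨q', hq'⟩ ⟨q', hq'⟩).2.1 h4)) hT₂ rfl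

end BuchiQuotient

namespace BuchiQuotient

/-! ### Reading instances from bit strings -/

/-- The bit of `x` at position `i`, which is `false` beyond the end. -/
def bitAt (x : List Bool) (i : ℕ) : Prop := x.getD i false = true

open scoped Classical in
/-- The length of the block of ones of `x` that starts at position `p`, as the number of the `i`
such that the positions `p, …, p + i` all hold ones. -/
noncomputable def run (x : List Bool) (p : ℕ) : ℕ :=
  ∑ i ∈ Finset.range x.length, if ∀ j, j < i + 1 → bitAt x (p + j) then 1 else 0

theorem not_bitAt_of_le {x : List Bool} {i : ℕ} (h : x.length ≤ i) : ¬ bitAt x i := by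
  rw [bitAt, List.getD_eq_getElem?_getD, List.getElem?_eq_none h]
  simp

theorem run_eq {x : List Bool} {p k : ℕ} (h : ∀ j < k, bitAt x (p + j))
    (hk : ¬ bitAt x (p + k)) : run x p = k := by
  classical
  have hle : k ≤ x.length := by
    rcases Nat.eq_zero_or_pos k with rfl | h0
    · omega
    · by_contra hlt
      exact not_bitAt_of_le (by omega) (h (k - 1) (by omega))
  have e : ∀ i, (∀ j, j < i + 1 → bitAt x (p + j)) ↔ i < k := by
    intro i
    refine ⟨fun hi => ?_, fun hi j hj => h j (by omega)⟩
    by_contra hlt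
    exact hk (hi k (by omega))
  have e' : (Finset.range x.length).filter (fun i => i < k) = Finset.range k := by
    ext i; simp; omega
  simp only [run, e]
  rw [← Finset.card_filter, e', Finset.card_range]

theorem run_spec (x : List Bool) (p : ℕ) :
    (∀ j < run x p, bitAt x (p + j)) ∧ ¬ bitAt x (p + run x p) := by
  classical
  have hex : ∃ k, ¬ bitAt x (p + k) := ⟨x.length, not_bitAt_of_le (by omega)⟩
  have hmin : ∀ j < Nat.find hex, bitAt x (p + j) := fun j hj =>
    not_not.1 (Nat.find_min hex hj)
  rw [run_eq hmin (Nat.find_spec hex)]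
  exact ⟨hmin, Nat.find_spec hex⟩

/-- The number of states. This and the following quantities are defined for every bit string, but
they make sense only for codes of instances, which are recognized by `Valid`. -/
noncomputable def nS (x : List Bool) : ℕ := run x 0

/-- The number of letters. -/
noncomputable def mS (x : List Bool) : ℕ := run x (nS x + 1)

/-- The initial state of the first automaton. -/
noncomputable def sS (x : List Bool) : ℕ := run x (nS x + mS x + 2)

/-- The initial state of the second automaton. -/
noncomputable def sS' (x : List Bool) : ℕ := run x (nS x + mS x + sS x + 3)

/-- The position at which the table of the accepting states starts. -/
noncomputable def offF (x : List Bool) : ℕ := nS x + mS x + sS x + sS' x + 4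

/-- The table of the accepting states. -/
def accB (x : List Bool) (q : ℕ) : Prop := bitAt x (offF x + q)

/-- The table of the transition relation. -/
def delB (x : List Bool) (q a r : ℕ) : Prop :=
  bitAt x (offF x + nS x + (q * (mS x * nS x) + (a * nS x + r)))

/-- The bit string is the code of an instance. -/
def Valid (x : List Bool) : Prop :=
  x.length = offF x + nS x + nS x * (mS x * nS x) ∧ sS x < nS x ∧ sS' x < nS x

theorem bitAt_append_left {x y : List Bool} {i : ℕ} (h : i < x.length) :
    bitAt (x ++ y) i ↔ bitAt x i := by
  simp [bitAt, List.getD_eq_getElem?_getD, List.getElem?_append_left h]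

theorem bitAt_append_right (x y : List Bool) (i : ℕ) :
    bitAt (x ++ y) (x.length + i) ↔ bitAt y i := by
  simp [bitAt, List.getD_eq_getElem?_getD, List.getElem?_append_right]

@[simp] theorem length_unary (k : ℕ) : (unary k).length = k + 1 := by simp [unary]

theorem bitAt_unary_of_lt {k j : ℕ} (h : j < k) (y : List Bool) : bitAt (unary k ++ y) j := by
  rw [bitAt_append_left (by simp; omega), unary, bitAt_append_left (by simpa using h)]
  simp [bitAt, List.getD_eq_getElem?_getD, h]

theorem not_bitAt_unary (k : ℕ) (y : List Bool) : ¬ bitAt (unary k ++ y) k := by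
  rw [bitAt_append_left (by simp), unary]
  have := bitAt_append_right (List.replicate k true) [false] 0
  rw [List.length_replicate, Nat.add_zero] at this
  rw [this]
  simp [bitAt]

theorem run_unary (u : List Bool) (k : ℕ) (y : List Bool) {p : ℕ} (hp : p = u.length) :
    run (u ++ (unary k ++ y)) p = k := by
  subst hp
  refine run_eq (fun j hj => ?_) ?_
  · rw [bitAt_append_right]; exact bitAt_unary_of_lt hj y
  · rw [bitAt_append_right]; exact not_bitAt_unary k y

/-- Entries of a concatenation of blocks of equal lengths. -/
theorem bitAt_flatMap {β : Type} {k : ℕ} (f : β → List Bool) (hf : ∀ b, (f b).length = k)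
    (l : List β) (i j : ℕ) (hj : j < k) (b : β) (hb : l[i]? = some b) :
    bitAt (l.flatMap f) (i * k + j) ↔ bitAt (f b) j := by
  induction l generalizing i with
  | nil => simp at hb
  | cons c l ih =>
    rw [List.flatMap_cons]
    cases i with
    | zero =>
      obtain rfl : c = b := by simpa using hb
      rw [Nat.zero_mul, Nat.zero_add, bitAt_append_left (by rw [hf]; exact hj)]
    | succ i =>
      rw [show (i + 1) * k + j = (f c).length + (i * k + j) by rw [hf]; ring,
        bitAt_append_right]
      exact ih i (by simpa using hb)

theorem bitAt_map_finRange {n : ℕ} (p : Fin n → Prop) [DecidablePred p] (q : Fin n) :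
    bitAt ((List.finRange n).map fun i => decide (p i)) q ↔ p q := by
  simp [bitAt, List.getD_eq_getElem?_getD]

namespace Instance

open scoped Classical in
/-- The table of the transition relation of an instance. -/
noncomputable def delTable (I : Instance) : List Bool :=
  (List.finRange I.n).flatMap fun q => (List.finRange I.m).flatMap fun a =>
    (List.finRange I.n).map fun r => decide ((q, a, r) ∈ I.aut.δ)

open scoped Classical in
theorem encode_eq (I : Instance) : I.encode = unary I.n ++ (unary I.m ++ (unary I.aut.start ++
    (unary I.start' ++ ((List.finRange I.n).map (fun q => decide (q ∈ I.aut.F)) ++ I.delTable)))) :=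
  rfl

theorem nS_encode (I : Instance) : nS I.encode = I.n := by
  rw [nS, encode_eq]
  exact run_unary [] I.n _ rfl

theorem mS_encode (I : Instance) : mS I.encode = I.m := by
  rw [mS, nS_encode, encode_eq]
  exact run_unary (unary I.n) I.m _ (by simp)

theorem sS_encode (I : Instance) : sS I.encode = I.aut.start := by
  rw [sS, nS_encode, mS_encode, encode_eq, ← List.append_assoc]
  exact run_unary _ _ _ (by simp; omega)

theorem sS'_encode (I : Instance) : sS' I.encode = I.start' := by
  rw [sS', nS_encode, mS_encode, sS_encode, encode_eq, ← List.append_assoc, ← List.append_assoc]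
  exact run_unary _ _ _ (by simp; omega)

theorem offF_encode (I : Instance) : offF I.encode = I.n + I.m + I.aut.start + I.start' + 4 := by
  rw [offF, nS_encode, mS_encode, sS_encode, sS'_encode]

theorem length_delTable (I : Instance) : I.delTable.length = I.n * (I.m * I.n) := by
  simp [delTable, List.length_flatMap]

theorem valid_encode (I : Instance) : Valid I.encode := by
  refine ⟨?_, ?_, ?_⟩
  · rw [offF_encode, nS_encode, mS_encode, encode_eq]
    simp only [List.length_append, length_unary, List.length_map, List.length_finRange,
      length_delTable]
    omega
  · rw [sS_encode, nS_encode]; exact I.aut.start.isLt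
  · rw [sS'_encode, nS_encode]; exact I.start'.isLt

theorem accB_encode (I : Instance) (q : Fin I.n) : accB I.encode q ↔ q ∈ I.aut.F := by
  classical
  rw [accB, offF_encode, encode_eq, ← List.append_assoc, ← List.append_assoc, ← List.append_assoc]
  have e : I.n + I.m + I.aut.start + I.start' + 4 =
      (((unary I.n ++ unary I.m) ++ unary I.aut.start) ++ unary I.start').length := by
    simp; omega
  rw [e, bitAt_append_right, bitAt_append_left (by simp), bitAt_map_finRange]

theorem delB_encode (I : Instance) (q : Fin I.n) (a : Fin I.m) (r : Fin I.n) :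
    delB I.encode q a r ↔ (q, a, r) ∈ I.aut.δ := by
  classical
  have hlt : (a : ℕ) * I.n + r < I.m * I.n := by
    have h1 : ((a : ℕ) + 1) * I.n ≤ I.m * I.n := Nat.mul_le_mul_right _ a.isLt
    have h2 := r.isLt
    rw [Nat.succ_mul] at h1
    omega
  rw [delB, offF_encode, nS_encode, mS_encode, encode_eq, ← List.append_assoc,
    ← List.append_assoc, ← List.append_assoc, ← List.append_assoc]
  have e : I.n + I.m + I.aut.start + I.start' + 4 + I.n =
      ((((unary I.n ++ unary I.m) ++ unary I.aut.start) ++ unary I.start') ++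
        (List.finRange I.n).map (fun q => decide (q ∈ I.aut.F))).length := by
    simp; omega
  rw [e, bitAt_append_right, delTable]
  rw [bitAt_flatMap (k := I.m * I.n) _ (by simp [List.length_flatMap]) _ _ _ hlt q (by simp),
    bitAt_flatMap (k := I.n) _ (by simp) _ _ _ r.isLt a (by simp), bitAt_map_finRange]

end Instance

/-- The instance read from a valid bit string. -/
noncomputable def decodeInstance (x : List Bool) (h : Valid x) : Instance where
  n := nS x
  m := mS x
  aut := { δ := {t | delB x t.1 t.2.1 t.2.2}, start := ⟨sS x, h.2.1⟩, F := {q | accB x q} }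
  start' := ⟨sS' x, h.2.2⟩

/-- A bit string is determined by the quantities read from it. -/
theorem eq_of_tables {x y : List Bool} (hx : Valid x) (hy : Valid y) (hn : nS x = nS y)
    (hm : mS x = mS y) (hs : sS x = sS y) (hs' : sS' x = sS' y)
    (hF : ∀ q < nS x, accB x q ↔ accB y q)
    (hD : ∀ q < nS x, ∀ a < mS x, ∀ r < nS x, delB x q a r ↔ delB y q a r) : x = y := by
  have hoff : offF x = offF y := by rw [offF, offF, hn, hm, hs, hs']
  have hlen : x.length = y.length := by rw [hx.1, hy.1, hoff, hn, hm]
  have key : ∀ i < x.length, bitAt x i ↔ bitAt y i := by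
    intro i hi
    have hrun : ∀ p, run x p = run y p → ∀ j ≤ run x p, (bitAt x (p + j) ↔ bitAt y (p + j)) := by
      intro p e j hj
      rcases Nat.lt_or_eq_of_le hj with hj | rfl
      · exact iff_of_true ((run_spec x p).1 j hj) ((run_spec y p).1 j (e ▸ hj))
      · refine iff_of_false (run_spec x p).2 ?_
        rw [e]
        exact (run_spec y p).2
    have r1 := hrun 0 hn
    have r2 := hrun (nS x + 1) (hm.trans (by rw [mS, hn]))
    have r3 := hrun (nS x + mS x + 2) (hs.trans (by rw [sS, hn, hm]))
    have r4 := hrun (nS x + mS x + sS x + 3) (hs'.trans (by rw [sS', hn, hm, hs]))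
    rw [← nS] at r1
    rw [← mS] at r2
    rw [← sS] at r3
    rw [← sS'] at r4
    have hi' := hi
    rw [hx.1] at hi'
    by_cases h1 : i ≤ nS x
    · simpa using r1 i h1
    by_cases h2 : i ≤ nS x + 1 + mS x
    · have := r2 (i - (nS x + 1)) (by omega)
      rwa [show nS x + 1 + (i - (nS x + 1)) = i by omega] at this
    by_cases h3 : i ≤ nS x + mS x + 2 + sS x
    · have := r3 (i - (nS x + mS x + 2)) (by omega)
      rwa [show nS x + mS x + 2 + (i - (nS x + mS x + 2)) = i by omega] at this
    by_cases h4 : i ≤ nS x + mS x + sS x + 3 + sS' x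
    · have := r4 (i - (nS x + mS x + sS x + 3)) (by omega)
      rwa [show nS x + mS x + sS x + 3 + (i - (nS x + mS x + sS x + 3)) = i by omega] at this
    have hoffx : offF x = nS x + mS x + sS x + sS' x + 4 := rfl
    by_cases h5 : i < offF x + nS x
    · have := hF (i - offF x) (by omega)
      rw [accB, accB, ← hoff] at this
      rwa [show offF x + (i - offF x) = i by omega] at this
    · obtain ⟨k, rfl⟩ : ∃ k, i = offF x + nS x + k := ⟨i - (offF x + nS x), by omega⟩
      have hk : k < nS x * (mS x * nS x) := by omega
      have hpos : 0 < mS x * nS x := Nat.pos_of_ne_zero fun h0 => by simp [h0] at hk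
      have hpos' : 0 < nS x := Nat.pos_of_ne_zero fun h0 => by simp [h0] at hpos
      have := hD (k / (mS x * nS x)) (Nat.div_lt_of_lt_mul (by rwa [mul_comm]))
        (k % (mS x * nS x) / nS x)
        (Nat.div_lt_of_lt_mul (by rw [mul_comm (nS x)]; exact Nat.mod_lt _ hpos))
        (k % (mS x * nS x) % nS x) (Nat.mod_lt _ hpos')
      rw [delB, delB, ← hoff, ← hn, ← hm] at this
      rwa [Nat.div_add_mod' (k % (mS x * nS x)), Nat.div_add_mod'] at this
  refine List.ext_getElem hlen fun i h1 h2 => ?_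
  have := key i h1
  simp only [bitAt, List.getD_eq_getElem?_getD, List.getElem?_eq_getElem h1,
    List.getElem?_eq_getElem h2, Option.getD_some] at this
  exact Bool.eq_iff_iff.2 this

/-- A valid string is the code of the instance read from it, because both have the same tables. -/
theorem exists_encode_iff (x : List Bool) : (∃ I : Instance, I.encode = x) ↔ Valid x := by
  constructor
  · rintro ⟨I, rfl⟩
    exact I.valid_encode
  · intro h
    let I := decodeInstance x h
    refine ⟨I, eq_of_tables I.valid_encode h I.nS_encode I.mS_encode I.sS_encode I.sS'_encode
      (fun q hq => ?_) fun q hq a ha r hr => ?_⟩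
    · rw [I.nS_encode] at hq
      exact I.accB_encode ⟨q, hq⟩
    · rw [I.nS_encode] at hq hr
      rw [I.mS_encode] at ha
      exact I.delB_encode ⟨q, hq⟩ ⟨a, ha⟩ ⟨r, hr⟩

/-! ### The algorithms -/

/-- `T` is the code of a class of words. -/
def IsMem (x : List Bool) (T : ℕ) : Prop :=
  Lfp (memOp (nS x) (mS x) (delB x) (accB x)) (cap (nS x)) T

/-- Refuter can force a win from the initial configuration. -/
def RefuterForces (x : List Bool) : Prop :=
  ∃ T, T < cap (nS x) ∧ IsEps (nS x) T ∧
    Lfp (loseOp (nS x) (IsMem x)) (nS x * nS x * cap (nS x)) (posCode (nS x) (sS x) (sS' x) T)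

theorem Instance.isMem_encode (I : Instance) (T : ℕ) :
    IsMem I.encode T ↔ ∃ w, Codes I.aut T w := by
  have h := lfp_memOp_iff (A := I.aut) (D := delB I.encode) (F := accB I.encode) I.delB_encode
    I.accB_encode T
  rwa [IsMem, I.nS_encode, I.mS_encode]

theorem Instance.refuterForces_encode (I : Instance) :
    RefuterForces I.encode ↔ I.aut.Lose I.aut.start I.start' (I.aut.cls []) := by
  rw [RefuterForces, I.nS_encode, I.sS_encode, I.sS'_encode]
  constructor
  · rintro ⟨T, hT, he, h⟩
    exact (lfp_loseOp_iff I.isMem_encode (Codes.nil_iff.2 ⟨hT, he⟩)).1 h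
  · intro h
    obtain ⟨T, hT⟩ := Codes.exists_of_word I.aut []
    exact ⟨T, hT.1, (Codes.nil_iff.1 hT).2, (lfp_loseOp_iff I.isMem_encode hT).2 h⟩

theorem mem_proverWinLanguage_iff (x : List Bool) :
    x ∈ Instance.proverWinLanguage ↔ Valid x ∧ ¬ RefuterForces x := by
  rw [← exists_encode_iff]
  constructor
  · rintro ⟨I, rfl, h⟩
    exact ⟨⟨I, rfl⟩, fun hl => NBA.proverHasWinningStrategy_iff.1 h (I.refuterForces_encode.1 hl)⟩
  · rintro ⟨⟨I, rfl⟩, h⟩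
    exact ⟨I, rfl, NBA.proverHasWinningStrategy_iff.2 fun hl => h (I.refuterForces_encode.2 hl)⟩

end BuchiQuotient

namespace BuchiQuotient

/-! ### Evaluability of the algorithms -/

variable {α : Type} {C : Ctx α} {X : α → List Bool}

protected theorem EvP.bitAt {i : α → ℕ} (hX : Ev C X) (hi : EvN C i) :
    EvP C fun y => bitAt (X y) (i y) :=
  EvP.getD hX hi

protected theorem EvN.run {p : α → ℕ} (hX : Ev C X) (hp : EvN C p) :
    EvN C fun y => run (X y) (p y) :=
  EvN.sum (EvN.length hX) (EvN.ite (EvP.forall_lt (.add .num_snd (.const 1))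
    (EvP.bitAt hX.num.num (.add hp.num.num .num_snd))) (.const 1) (.const 0))

protected theorem EvN.nS (hX : Ev C X) : EvN C fun y => nS (X y) := .run hX (.const 0)

protected theorem EvN.mS (hX : Ev C X) : EvN C fun y => mS (X y) :=
  .run hX (.add (.nS hX) (.const 1))

protected theorem EvN.sS (hX : Ev C X) : EvN C fun y => sS (X y) :=
  .run hX (.add (.add (.nS hX) (.mS hX)) (.const 2))

protected theorem EvN.sS' (hX : Ev C X) : EvN C fun y => sS' (X y) :=
  .run hX (.add (.add (.add (.nS hX) (.mS hX)) (.sS hX)) (.const 3))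

protected theorem EvN.offF (hX : Ev C X) : EvN C fun y => offF (X y) :=
  .add (.add (.add (.add (.nS hX) (.mS hX)) (.sS hX)) (.sS' hX)) (.const 4)

protected theorem EvP.accB {q : α → ℕ} (hX : Ev C X) (hq : EvN C q) :
    EvP C fun y => accB (X y) (q y) :=
  .bitAt hX (.add (.offF hX) hq)

protected theorem EvP.delB {q a r : α → ℕ} (hX : Ev C X) (hq : EvN C q) (ha : EvN C a)
    (hr : EvN C r) : EvP C fun y => delB (X y) (q y) (a y) (r y) :=
  .bitAt hX (.add (.add (.offF hX) (.nS hX))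
    (.add (.mul hq (.mul (.mS hX) (.nS hX))) (.add (.mul ha (.nS hX)) hr)))

protected theorem EvP.valid (hX : Ev C X) : EvP C fun y => Valid (X y) :=
  .and (.eq (.length hX) (.add (.add (.offF hX) (.nS hX))
    (.mul (.nS hX) (.mul (.mS hX) (.nS hX))))) (.and (.lt (.sS hX) (.nS hX))
      (.lt (.sS' hX) (.nS hX)))

section

variable {n T T' p q : α → ℕ}

protected theorem EvP.relBit (hn : EvN C n) (hT : EvN C T) (hp : EvN C p) (hq : EvN C q) :
    EvP C fun y => RelBit (n y) (T y) (p y) (q y) :=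
  .testBit hT (.mul (.const 2) (.add (.mul hp hn) hq))

protected theorem EvP.accBit (hn : EvN C n) (hT : EvN C T) (hp : EvN C p) (hq : EvN C q) :
    EvP C fun y => AccBit (n y) (T y) (p y) (q y) :=
  .testBit hT (.add (.mul (.const 2) (.add (.mul hp hn) hq)) (.const 1))

protected theorem EvP.relProd (hn : EvN C n) (hT : EvN C T) (hT' : EvN C T') (hp : EvN C p)
    (hq : EvN C q) : EvP C fun y => RelProd (n y) (T y) (T' y) (p y) (q y) :=
  .exists_lt hn (.and (.relBit hn.num hT.num hp.num .num_snd)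
    (.relBit hn.num hT'.num .num_snd hq.num))

protected theorem EvP.accProd (hn : EvN C n) (hT : EvN C T) (hT' : EvN C T') (hp : EvN C p)
    (hq : EvN C q) : EvP C fun y => AccProd (n y) (T y) (T' y) (p y) (q y) :=
  .exists_lt hn (.or
    (.and (.accBit hn.num hT.num hp.num .num_snd) (.relBit hn.num hT'.num .num_snd hq.num))
    (.and (.relBit hn.num hT.num hp.num .num_snd) (.accBit hn.num hT'.num .num_snd hq.num)))

protected theorem EvP.isEps (hn : EvN C n) (hT : EvN C T) : EvP C fun y => IsEps (n y) (T y) :=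
  .forall_lt hn (.forall_lt hn.num (.and
    (.iff (.relBit hn.num.num hT.num.num EvN.num_snd.num .num_snd) (.eq EvN.num_snd.num .num_snd))
    (.not (.accBit hn.num.num hT.num.num EvN.num_snd.num .num_snd))))

protected theorem EvP.isIdem (hn : EvN C n) (hT : EvN C T) : EvP C fun y => IsIdem (n y) (T y) :=
  .forall_lt hn (.forall_lt hn.num (.and
    (.iff (.relProd hn.num.num hT.num.num hT.num.num EvN.num_snd.num .num_snd)
      (.relBit hn.num.num hT.num.num EvN.num_snd.num .num_snd))
    (.iff (.accProd hn.num.num hT.num.num hT.num.num EvN.num_snd.num .num_snd)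
      (.accBit hn.num.num hT.num.num EvN.num_snd.num .num_snd))))

end

/-- The context provides the bit string `X` and enough room for numbers up to `cap (nS X)`. -/
structure EvInput (C : Ctx α) (X : α → List Bool) : Prop where
  ev : Ev C X
  cap : EvN C fun y => cap (nS (X y))

namespace EvInput

protected theorem num (h : EvInput C X) : EvInput C.num fun y => X y.1 := ⟨h.ev.num, h.cap.num⟩

protected theorem arr (h : EvInput C X) : EvInput C.arr fun y => X y.1 := ⟨h.ev.arr, h.cap.arr⟩

protected theorem nS (h : EvInput C X) : EvN C fun y => nS (X y) := .nS h.ev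

end EvInput

protected theorem EvP.isStep {T T' a : α → ℕ} (hX : EvInput C X) (hT' : EvN C T') (ha : EvN C a)
    (hT : EvN C T) :
    EvP C fun y => IsStep (nS (X y)) (delB (X y)) (accB (X y)) (T' y) (a y) (T y) := by
  have hn := hX.nS
  have hp : EvN C.num.num.num fun y => y.1.1.2 := EvN.num_snd.num.num
  have hq : EvN C.num.num.num fun y => y.1.2 := EvN.num_snd.num
  have hD : EvP C.num.num.num fun y => delB (X y.1.1.1) y.2 (a y.1.1.1) y.1.2 :=
    .delB hX.ev.num.num.num .num_snd ha.num.num.num hq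
  have hR := EvP.relBit hn.num.num.num hT'.num.num.num hp .num_snd
  exact .forall_lt hn (.forall_lt hn.num (.and
    (.iff (.relBit hn.num.num hT.num.num EvN.num_snd.num .num_snd)
      (.exists_lt hn.num.num (.and hR hD)))
    (.iff (.accBit hn.num.num hT.num.num EvN.num_snd.num .num_snd)
      (.exists_lt hn.num.num (.or
        (.and (.accBit hn.num.num.num hT'.num.num.num hp .num_snd) hD)
        (.and hR (.and hD (.accB hX.ev.num.num.num hq))))))))

protected theorem EvP.isMem {T : α → ℕ} (hX : EvInput C X) (hT : EvN C T) :
    EvP C fun y => IsMem (X y) (T y) :=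
  EvP.lfp (fun _ => memOp_mono _ _ _ _) hX.cap hT (.or (.isEps hX.arr.num.nS .num_snd)
    (.exists_lt hX.arr.num.cap (.and (.getD Ev.arr_snd.num.num .num_snd)
      (.exists_lt (.mS hX.arr.num.num.ev)
        (.isStep hX.arr.num.num.num EvN.num_snd.num .num_snd EvN.num_snd.num.num)))))

protected theorem EvN.posCode {p p' T : α → ℕ} (hX : EvInput C X) (hp : EvN C p) (hp' : EvN C p')
    (hT : EvN C T) : EvN C fun y => posCode (nS (X y)) (p y) (p' y) (T y) :=
  .add (.mul (.add (.mul hp hX.nS) hp') hX.cap) hT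

protected theorem EvP.loseOp {A : α → List Bool} {i : α → ℕ} (hX : EvInput C X) (hA : Ev C A)
    (hi : EvN C i) :
    EvP C fun y => loseOp (nS (X y)) (IsMem (X y)) (fun j => (A y).getD j false = true) (i y) := by
  -- the variables bound in turn by the quantifiers of the definition of `loseOp`
  have hp : EvN C.num fun y => y.2 := .num_snd
  have hp' : EvN C.num.num fun y => y.2 := .num_snd
  have hT : EvN C.num.num.num fun y => y.2 := .num_snd
  have hT₁ : EvN C.num.num.num.num fun y => y.2 := .num_snd
  have hT₂ : EvN C.num.num.num.num.num fun y => y.2 := .num_snd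
  have hq : EvN C.num.num.num.num.num.num fun y => y.2 := .num_snd
  have hq' : EvN C.num.num.num.num.num.num.num fun y => y.2 := .num_snd
  have hr : EvN C.num.num.num.num.num.num.num.num fun y => y.2 := .num_snd
  have h1 := hX.num
  have h2 := h1.num
  have h3 := h2.num
  have h4 := h3.num
  have h5 := h4.num
  have h6 := h5.num
  have h7 := h6.num
  have h8 := h7.num
  exact .exists_lt hX.nS (.exists_lt h1.nS (.exists_lt h2.cap (.and
    (.eq hi.num.num.num (.posCode h3 hp.num.num hp'.num hT))
    (.exists_lt h3.cap (.and (.isMem h4 hT₁) (.exists_lt h4.cap (.and (.isMem h5 hT₂)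
      (.exists_lt h5.nS (.and
        (.relBit h6.nS hT₁.num.num hp.num.num.num.num.num hq)
        (.and (.accBit h6.nS hT₂.num hq hq) (.and (.isIdem h6.nS hT₂.num)
          (.forall_lt h6.nS (.imp
            (.exists_lt h7.nS (.and
              (.relProd h8.nS hT.num.num.num.num.num hT₁.num.num.num.num
                hp'.num.num.num.num.num.num hr)
              (.relBit h8.nS hT₂.num.num.num hr hq'.num)))
            (.imp (.accBit h7.nS hT₂.num.num hq' hq')
              (.getD hA.num.num.num.num.num.num.num
                (.posCode h7 hq.num hq' hT₂.num.num))))))))))))))))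

protected theorem EvP.refuterForces (hX : EvInput C X) : EvP C fun y => RefuterForces (X y) :=
  .exists_lt hX.cap (.and (.isEps hX.num.nS .num_snd)
    (.lfp (fun _ => loseOp_mono _ _) (.mul (.mul hX.num.nS hX.num.nS) hX.num.cap)
      (.posCode hX.num (.sS hX.num.ev) (.sS' hX.num.ev) .num_snd)
      (.loseOp hX.num.arr.num Ev.arr_snd.num .num_snd)))

/-! ### Exponential time -/

/-- The context of an input of length `n`, with measure `2 ^ (n + 2) ^ 3`. As an instance has at
most `n` states, this is at least the number `cap` of codes of pairs of relations. -/
def inputCtx (ea : α → List Bool) : Ctx α where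
  lay a := [ea a]
  μ a := 2 ^ ((ea a).length + 2) ^ 3
  two_le a := by
    have : 1 ≤ ((ea a).length + 2) ^ 3 := Nat.one_le_pow _ _ (by omega)
    calc 2 = 2 ^ 1 := rfl
      _ ≤ _ := Nat.pow_le_pow_right (by omega) this
  length_le a l hl := by
    obtain rfl := List.mem_singleton.1 hl
    calc (ea a).length ≤ (ea a).length + 2 := by omega
      _ ≤ ((ea a).length + 2) ^ 3 := Nat.le_self_pow (by omega) _
      _ ≤ _ := Nat.lt_two_pow_self.le

theorem nS_le_length (x : List Bool) : nS x ≤ x.length := by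
  by_contra h
  exact not_bitAt_of_le (by omega) ((run_spec x 0).1 x.length (by rw [← nS]; omega))

theorem evInput_inputCtx (ea : α → List Bool) : EvInput (inputCtx ea) ea := by
  have hev : Ev (inputCtx ea) ea := .var 0 fun _ => rfl
  refine ⟨hev, .two_pow (.mul (.const 2) (.mul (.nS hev) (.nS hev))) ⟨1, fun a => ?_⟩⟩
  rw [pow_one]
  refine Nat.pow_le_pow_right (by omega) ?_
  have h := nS_le_length (ea a)
  calc 2 * (nS (ea a) * nS (ea a))
      ≤ ((ea a).length + 2) * (((ea a).length + 2) * ((ea a).length + 2)) := by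
        gcongr <;> omega
    _ = _ := by ring

theorem inEXPTIME_proverWinLanguage : InEXPTIME Instance.proverWinLanguage := by
  classical
  have hX := evInput_inputCtx fun x : List Bool => x
  have h : EvP (inputCtx fun x : List Bool => x) fun x => x ∈ Instance.proverWinLanguage :=
    (EvP.and (.valid hX.ev) (.not (.refuterForces hX))).of_iff fun x =>
      (mem_proverWinLanguage_iff x).symm
  refine computableInExpTime_of_ev (inputCtx fun x => x) (fun _ => rfl) 3 (fun _ => rfl)
    (fun x => [(decide (x ∈ Instance.proverWinLanguage), false)])
    ((Ev.cond h (.const [true, false]) (.const [false, false])).of_eq fun x => ?_) Prod.fst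
    fun x => ?_
  · by_cases hx : x ∈ Instance.proverWinLanguage <;> simp [hx]
  · simp [Computability.encodeBool]

/-- The two bits that code a symbol of the written form of a transition monoid. -/
def symBits : Option (Fin 3) → Bool × Bool
  | none => (false, false)
  | some 0 => (false, true)
  | some 1 => (true, false)
  | some 2 => (true, true)

/-- The symbol coded by two bits. -/
def bitsSym : Bool × Bool → Option (Fin 3)
  | (false, false) => none
  | (false, true) => some 0
  | (true, false) => some 1
  | (true, true) => some 2

theorem bitsSym_symBits (a : Option (Fin 3)) : bitsSym (symBits a) = a := by
  rcases a with _ | a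
  · rfl
  · fin_cases a <;> rfl

/-- The bits of a word over the symbols. -/
def wordBits (w : List (Option (Fin 3))) : List Bool :=
  w.flatMap fun a => [(symBits a).1, (symBits a).2]

open scoped Classical in
/-- The value at `(p, q)` of the function of a class, given its two relations. -/
noncomputable def entry (R A : ℕ → ℕ → Prop) (p q : ℕ) : Fin 3 :=
  if A p q then 0 else if R p q then 2 else 1

/-- The table of a class, given its two relations. -/
noncomputable def table (n : ℕ) (R A : ℕ → ℕ → Prop) : List (Option (Fin 3)) :=
  ((List.range n).flatMap fun p => (List.range n).flatMap fun q => [some (entry R A p q)]) ++ [none]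

protected theorem Ev.table {n : α → ℕ} {R A : α → ℕ → ℕ → Prop} (hn : EvN C n)
    (hR : EvP C.num.num fun y => R y.1.1 y.1.2 y.2)
    (hA : EvP C.num.num fun y => A y.1.1 y.1.2 y.2) :
    Ev C fun x => wordBits (table (n x) (R x) (A x)) := by
  classical
  have h : Ev C.num.num fun y => wordBits [some (entry (R y.1.1) (A y.1.1) y.1.2 y.2)] := by
    refine (Ev.cond hA (.const [false, true]) (Ev.cond hR (.const [true, true])
      (.const [true, false]))).of_eq fun y => ?_
    by_cases h₁ : A y.1.1 y.1.2 y.2 <;> by_cases h₂ : R y.1.1 y.1.2 y.2 <;>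
      simp [entry, wordBits, h₁, h₂] <;> exact ⟨rfl, rfl⟩
  refine (Ev.append (Ev.flatMap (f := fun x p => (List.range (n x)).flatMap fun q =>
    wordBits [some (entry (R x) (A x) p q)]) hn (Ev.flatMap (f := fun (y : α × ℕ) q =>
      wordBits [some (entry (R y.1) (A y.1) y.2 q)]) hn.num h))
    (.const [false, false])).of_eq fun x => ?_
  simp [wordBits, BuchiQuotient.table, List.flatMap_assoc, symBits]

open scoped Classical in
/-- The list of the numbers below `cap (nS x)` that code classes of words. -/
noncomputable def memList (x : List Bool) : List ℕ :=
  (List.range (cap (nS x))).filter fun T => decide (IsMem x T)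

/-- Concatenation over the codes of all classes. -/
protected theorem Ev.flatMap_memList {f : α → ℕ → List Bool} (hX : EvInput C X)
    (hf : Ev C.num fun y => f y.1 y.2) : Ev C fun x => (memList (X x)).flatMap (f x) := by
  classical
  refine (Ev.flatMap (f := fun x T => if IsMem (X x) T then f x T else []) hX.cap
    (Ev.ite (.isMem hX.num .num_snd) hf .nil)).of_eq fun x => ?_
  rw [memList]
  induction List.range (BuchiQuotient.cap (nS (X x))) with
  | nil => rfl
  | cons T l ih => by_cases h : IsMem (X x) T <;> simp [h, ih]

/-- The transition monoid, written out along the list of codes of its elements. -/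
noncomputable def monoidTable (x : List Bool) : List (Option (Fin 3)) :=
  (memList x).flatMap (fun T => table (nS x) (RelBit (nS x) T) (AccBit (nS x) T)) ++
    ([none] ++ (memList x).flatMap fun T => (memList x).flatMap fun T' =>
      table (nS x) (RelProd (nS x) T T') (AccProd (nS x) T T'))

protected theorem Ev.monoidTable (hX : EvInput C X) :
    Ev C fun x => wordBits (monoidTable (X x)) := by
  have h1 : Ev C fun x => (memList (X x)).flatMap fun T =>
      wordBits (table (nS (X x)) (RelBit (nS (X x)) T) (AccBit (nS (X x)) T)) := by
    have h3 := hX.num.num.num.nS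
    have hT : EvN C.num.num.num fun y => y.1.1.2 := EvN.num_snd.num.num
    exact .flatMap_memList hX (.table hX.num.nS (.relBit h3 hT EvN.num_snd.num .num_snd)
      (.accBit h3 hT EvN.num_snd.num .num_snd))
  have h2 : Ev C fun x => (memList (X x)).flatMap fun T => (memList (X x)).flatMap fun T' =>
      wordBits (table (nS (X x)) (RelProd (nS (X x)) T T') (AccProd (nS (X x)) T T')) := by
    have h4 := hX.num.num.num.num.nS
    have hT : EvN C.num.num.num.num fun y => y.1.1.1.2 := EvN.num_snd.num.num.num
    have hT' : EvN C.num.num.num.num fun y => y.1.1.2 := EvN.num_snd.num.num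
    exact .flatMap_memList hX (.flatMap_memList hX.num (.table hX.num.num.nS
      (.relProd h4 hT hT' EvN.num_snd.num .num_snd)
      (.accProd h4 hT hT' EvN.num_snd.num .num_snd)))
  refine (h1.append (.append (.const [false, false]) h2)).of_eq fun x => ?_
  simp [wordBits, BuchiQuotient.monoidTable, List.flatMap_assoc, symBits]

/-! ### The transition monoid of an instance -/

namespace Instance

variable (I : Instance)

open scoped Classical in
/-- The class with code `T`. -/
noncomputable def clsOfCode (T : ℕ) : I.aut.TransMonoid :=
  if h : ∃ w, Codes I.aut T w then I.aut.cls h.choose else I.aut.cls []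

theorem clsOfCode_eq {T : ℕ} {w : List (Fin I.m)} (h : Codes I.aut T w) :
    I.clsOfCode T = I.aut.cls w := by
  have h' : ∃ w, Codes I.aut T w := ⟨w, h⟩
  rw [clsOfCode, dif_pos h']
  exact (h'.choose_spec.cls_eq_iff h).2 rfl

/-- The elements of the transition monoid, in the order of their codes. -/
noncomputable def elements : List I.aut.TransMonoid := (memList I.encode).map I.clsOfCode

theorem mem_memList {T : ℕ} : T ∈ memList I.encode ↔ ∃ w, Codes I.aut T w := by
  classical
  rw [memList, List.mem_filter, List.mem_range, decide_eq_true_iff, I.isMem_encode, I.nS_encode]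
  exact ⟨fun h => h.2, fun ⟨w, h⟩ => ⟨h.1, w, h⟩⟩

theorem elements_nodup : I.elements.Nodup := by
  refine List.Nodup.map_on (fun T hT T' hT' h => ?_) ((List.nodup_range).filter _)
  obtain ⟨w, hw⟩ := I.mem_memList.1 hT
  obtain ⟨w', hw'⟩ := I.mem_memList.1 hT'
  rw [I.clsOfCode_eq hw, I.clsOfCode_eq hw'] at h
  exact (hw.cls_eq_iff hw').1 h

theorem mem_elements (c : I.aut.TransMonoid) : c ∈ I.elements := by
  obtain ⟨w, rfl⟩ := I.aut.cls_surjective c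
  obtain ⟨T, hT⟩ := Codes.exists_of_word I.aut w
  exact List.mem_map.2 ⟨T, I.mem_memList.2 ⟨w, hT⟩, I.clsOfCode_eq hT⟩

theorem table_eq_tableWord {R A : ℕ → ℕ → Prop} {w : List (Fin I.m)}
    (hR : ∀ p q : Fin I.n, R p q ↔ I.aut.Reach p w q)
    (hA : ∀ p q : Fin I.n, A p q ↔ I.aut.AccReach p w q) :
    table I.n R A = I.tableWord (I.aut.cls w) := by
  have hfin : ∀ {β : Type} (f : ℕ → List β),
      (List.range I.n).flatMap f = (List.finRange I.n).flatMap fun p : Fin I.n => f p := by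
    intro β f
    rw [← List.map_coe_finRange_eq_range, List.flatMap_map]
  rw [table, tableWord, hfin]
  congr 2
  funext p
  rw [hfin, List.map_eq_flatMap]
  congr 1
  funext q
  have hR := hR p q
  have hA := hA p q
  rw [NBA.clsProfile_cls, entry, NBA.profile]
  split_ifs <;> simp_all

theorem monoidTable_encode : monoidTable I.encode = I.monoidWord I.elements := by
  rw [monoidTable, monoidWord, elements, List.flatMap_map, List.flatMap_map, I.nS_encode]
  congr 1
  · refine List.flatMap_congr fun T hT => ?_
    obtain ⟨w, hw⟩ := I.mem_memList.1 hT
    rw [I.clsOfCode_eq hw]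
    exact I.table_eq_tableWord (fun p q => (hw.2 p q).1) fun p q => (hw.2 p q).2
  · rw [List.singleton_append]
    congr 1
    refine List.flatMap_congr fun T hT => ?_
    rw [List.flatMap_map]
    refine List.flatMap_congr fun T' hT' => ?_
    obtain ⟨w, hw⟩ := I.mem_memList.1 hT
    obtain ⟨w', hw'⟩ := I.mem_memList.1 hT'
    rw [I.clsOfCode_eq hw, I.clsOfCode_eq hw', ← I.aut.cls_append]
    exact I.table_eq_tableWord (hw.relProd_iff hw') (hw.accProd_iff hw')

theorem monoidComputableInExpTime : MonoidComputableInExpTime := by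
  refine ⟨elements, fun I => ⟨I.elements_nodup, I.mem_elements⟩, ?_⟩
  refine computableInExpTime_of_ev (inputCtx encode) (fun _ => rfl) 3 (fun _ => rfl)
    (fun I => (I.monoidWord I.elements).map symBits)
    ((Ev.monoidTable (evInput_inputCtx encode)).of_eq fun I => ?_) bitsSym fun I => ?_
  · rw [I.monoidTable_encode, wordBits, List.flatMap_map]
  · rw [List.map_map]
    exact (List.map_id'' bitsSym_symBits _).symm

end Instance

end BuchiQuotient

theorem mainTheorem7 :
    -- whether Prover has a winning strategy is decidable in EXPTIME
    BuchiQuotient.InEXPTIME BuchiQuotient.Instance.proverWinLanguage ∧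
    -- the arena is finite, of size `2 ^ O(|Q|² log |Q|)`
    (∃ C : ℝ, ∀ (Q : Type*) (S : Type*) [Fintype Q] (A : BuchiQuotient.NBA Q S),
      Finite A.Pos ∧
      (2 ≤ Fintype.card Q →
        (Nat.card A.Pos : ℝ) ≤
          (2 : ℝ) ^ (C * (Fintype.card Q : ℝ) ^ 2 * Real.log (Fintype.card Q)))) ∧
    -- the transition monoid is computable in exponential time
    BuchiQuotient.Instance.MonoidComputableInExpTime ∧
    -- the game is a reachability game: Refuter wins a play iff it reaches a configuration in
    -- which Prover is to move and stuck
    (∀ (Q : Type*) (S : Type*) (A : BuchiQuotient.NBA Q S) (q₀ : Q) (π : A.Play q₀),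
      π.RefuterWins ↔ ∃ n x, π.pos n = some x ∧ x.IsProver ∧ A.Stuck x) :=
  ⟨BuchiQuotient.inEXPTIME_proverWinLanguage,
    ⟨16, fun _ _ _ A => ⟨inferInstance, A.card_pos_le⟩⟩,
    BuchiQuotient.Instance.monoidComputableInExpTime,
    fun _ _ _ _ π => π.refuterWins_iff⟩
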